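/- Let $\psi:\mathbb{R}\to\mathbb{R}$ be a Sotomayor--Teixeira transition function, i.e. a $C^1$ function with $\psi'(v)>0$ for $|v|<1$, $\psi(v)=1$ for $v\ge 1$ and $\psi(v)=-1$ for $v\le -1$. For $a,\varepsilon>0$ consider the regularization of the linear-switching oscillator, $$\dot x=1,\qquad \varepsilon\dot v=-a\varepsilon v-f_L(x,\psi(v)),\qquad f_L(x,\lambda)=\bigl[1+(1+\lambda)\cos\pi x\bigr]\sin\tfrac{\pi x}{2},$$ where $v=y/\varepsilon$. Then there exist $a_0>0$ and $\varepsilon_0>0$ such that for all $a\in(0,a_0)$ and all $\varepsilon\in(0,\varepsilon_0)$ this system has a solution $t\mapsto(x(t),v(t))$, $t\in\mathbb{R}$, with the following properties. (i) It is $4$-periodic: $(x(t+4),v(t+4))=(x(t)+4,v(t))$ for all $t$, and $4$ is the least positive number with this property. (ii) It is non-sliding: whenever $|v(t)|<1$, there is no $w\in(-1,1)$ with $f_L(x(t),\psi(w))=0$. That is, the orbit is inside the switching layer $\{|v|<1\}$ only over values of $x$ over which the critical manifold $\{(x,w): f_L(x,\psi(w))=0,\ |w|<1\}$ has no point; in particular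 it never meets the critical manifold. (iii) It is locally asymptotically stable: its orbit $\Gamma=\{(x(t),v(t)):t\in\mathbb{R}\}$ is Lyapunov stable (for every $\eta>0$ there is $\delta>0$ such that every solution on $[0,\infty)$ starting at distance less than $\delta$ from $\Gamma$ stays at distance less than $\eta$ from $\Gamma$ for all $t\ge0$) and locally attracting (there is $\delta>0$ such that for every solution on $[0,\infty)$ starting at distance less than $\delta$ from $\Gamma$ the distance to $\Gamma$ tends to $0$ as $t\to\infty$). -/

import Mathlib

namespace SwitchedOscillator

/-- A Sotomayor–Teixeira transition function: a `C¹` function which is strictly increasing with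
positive derivative on `(-1, 1)` and coincides with the sign function for `|v| ≥ 1`. -/
structure IsTransition (ψ : ℝ → ℝ) : Prop where
  contDiff : ContDiff ℝ 1 ψ
  deriv_pos : ∀ v : ℝ, |v| < 1 → 0 < deriv ψ v
  eq_one : ∀ v : ℝ, 1 ≤ v → ψ v = 1
  eq_neg_one : ∀ v : ℝ, v ≤ -1 → ψ v = -1

/-- The linear-switching forcing
`f_L(x, l) = (1 + l)/2 * sin (3πx/2) + (1 - l)/2 * sin (πx/2)`, written in factorized form. -/
noncomputable def forcing (x l : ℝ) : ℝ :=
  (1 + (1 + l) * Real.cos (Real.pi * x)) * Real.sin (Real.pi * x / 2)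

/-- The planar vector field of the regularized system
`x' = 1`, `ε v' = -a ε v - f_L(x, ψ(v))`, where `v = y / ε`. -/
noncomputable def regField (ψ : ℝ → ℝ) (a ε : ℝ) (p : ℝ × ℝ) : ℝ × ℝ :=
  (1, (-(a * ε * p.2) - forcing p.1 (ψ p.2)) / ε)

/-- The critical manifold `{(x, v) : f_L(x, ψ(v)) = 0, |v| < 1}`, which replaces the sliding
manifold of the discontinuous system. -/
def criticalManifold (ψ : ℝ → ℝ) : Set (ℝ × ℝ) :=
  {p | forcing p.1 (ψ p.2) = 0 ∧ |p.2| < 1}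

/-- A curve does not slide if it is inside the switching layer `|v| < 1` only over abscissae `x`
over which the critical manifold has no point (that is, it traverses the layer over crossing
regions only). In particular it does not meet the critical manifold. -/
def NonSliding (ψ : ℝ → ℝ) (γ : ℝ → ℝ × ℝ) : Prop :=
  ∀ t : ℝ, |(γ t).2| < 1 → ∀ w : ℝ, ((γ t).1, w) ∉ criticalManifold ψ

/-- `γ` is `T`-periodic with least period `T`. The system is periodic in the phase `x`, which
advances by `T` while `v` returns to its value. -/
def HasLeastPeriod (γ : ℝ → ℝ × ℝ) (T : ℝ) : Prop :=
  0 < T ∧ (∀ t : ℝ, γ (t + T) = γ t + (T, 0)) ∧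
    ∀ S : ℝ, 0 < S → (∀ t : ℝ, γ (t + S) = γ t + (S, 0)) → T ≤ S

/-- Local asymptotic stability of a set `Γ` for the forward solutions of the autonomous system
with vector field `F`: Lyapunov stability together with local attractivity. -/
def IsLocallyAsymptoticallyStable (F : ℝ × ℝ → ℝ × ℝ) (Γ : Set (ℝ × ℝ)) : Prop :=
  (∀ η : ℝ, 0 < η → ∃ δ : ℝ, 0 < δ ∧
    ∀ σ : ℝ → ℝ × ℝ, IsIntegralCurveOn σ (fun _ => F) (Set.Ici 0) →
      Metric.infDist (σ 0) Γ < δ → ∀ t : ℝ, 0 ≤ t → Metric.infDist (σ t) Γ < η) ∧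
  ∃ δ : ℝ, 0 < δ ∧
    ∀ σ : ℝ → ℝ × ℝ, IsIntegralCurveOn σ (fun _ => F) (Set.Ici 0) →
      Metric.infDist (σ 0) Γ < δ →
        Filter.Tendsto (fun t => Metric.infDist (σ t) Γ) Filter.atTop (nhds 0)

end SwitchedOscillator

/-!
Write `y = ε v` and use the phase `x` as time. The reflection `x ↦ -x` turns the damping `a` of the
scalar equation `y' = -a y - f_L(x, ψ(y / ε))` into `-a`, so that a solution is `4`-periodic in `x`
as soon as the solutions `Y_c` with damping `a` and `Z_c` with damping `-a` that start at `y = c`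
over `x = 0` take the same value at `x = 2`. For `c` in a suitable range both cross the layer
`|y| ≤ ε` once, downwards, over a window of phases where `f_L(x, l)` is bounded below for all
`|l| ≤ 1`; hence there is no sliding.

At the lower end of the range the orbit enters the layer near `x = 1/3`, where `sin (3πx/2)` is
maximal; at the upper end it enters near `x = 2/3`, where the forcing above the layer nearly
vanishes, so that a change of the damping strongly displaces the entry. The difference
`Y_c(2) - Z_c(2)` therefore has opposite signs at the two ends, and it vanishes for some `c` in
between.

For stability compare two neighbouring orbits. In the layer take `y` as the independent variable and
the phase `X(y)` as the unknown: the logarithms of the separations `X₂ - X₁` for the dampings `a`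
and `-a` change by amounts that differ by `O(ε a)` only. Outside the layer the field is affine in
`y`, and there the damping gives `Y₂(2) - Y₁(2) ≤ exp (-a) * (Z₂(2) - Z₁(2))`, which says that the
map from `x = -2` to `x = 2` is a contraction near the periodic orbit.
-/

open Set Filter Topology Real
open scoped NNReal

namespace SwitchedOscillator

section IntegralCurve

variable {E : Type*} [NormedAddCommGroup E] [NormedSpace ℝ E] {v : ℝ → E → E} {K : ℝ≥0}

theorem exists_eq_forall_Ioo_hasDerivAt_of_lipschitzWith [CompleteSpace E]
    (hv : ∀ t, LipschitzWith K (v t)) (hcont : ∀ y, Continuous fun t => v t y) {T : ℝ} {M : ℝ≥0}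
    (hM : ∀ t ∈ Icc (-T) T, ∀ y, ‖v t y‖ ≤ M) {t₀ : ℝ} (ht₀ : |t₀| < T) (y₀ : E) :
    ∃ Y : ℝ → E, Y t₀ = y₀ ∧ ∀ t ∈ Ioo (-T) T, HasDerivAt Y (v t (Y t)) t := by
  have hmem := abs_lt.1 ht₀
  have hT : 0 < T := (abs_nonneg _).trans_lt ht₀
  have hPL : IsPicardLindelof v (tmin := -T) (tmax := T) ⟨t₀, hmem.1.le, hmem.2.le⟩ y₀
      (M * ⟨2 * T, by positivity⟩) 0 M K :=
    { lipschitzOnWith := fun t _ => (hv t).lipschitzOnWith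
      continuousOn := fun y _ => (hcont y).continuousOn
      norm_le := fun t ht y _ => hM t ht y
      mul_max_le := by
        push_cast
        rw [sub_zero]
        refine mul_le_mul_of_nonneg_left (max_le ?_ ?_) M.2
        · change T - t₀ ≤ 2 * T; linarith [hmem.1]
        · change t₀ - -T ≤ 2 * T; linarith [hmem.2] }
  obtain ⟨Y, hY₀, hY⟩ := hPL.exists_eq_forall_mem_Icc_hasDerivWithinAt₀
  exact ⟨Y, hY₀, fun t ht => (hY t (Ioo_subset_Icc_self ht)).hasDerivAt (Icc_mem_nhds ht.1 ht.2)⟩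

theorem eqOn_Ioo_of_lipschitzWith (hv : ∀ t, LipschitzWith K (v t)) {a b t₀ : ℝ}
    (ht₀ : t₀ ∈ Ioo a b) {Y Z : ℝ → E} (hY : ∀ t ∈ Ioo a b, HasDerivAt Y (v t (Y t)) t)
    (hZ : ∀ t ∈ Ioo a b, HasDerivAt Z (v t (Z t)) t) (h : Y t₀ = Z t₀) : EqOn Y Z (Ioo a b) :=
  ODE_solution_unique_of_mem_Ioo (s := fun _ => univ) (fun t _ => (hv t).lipschitzOnWith) ht₀
    (fun t ht => ⟨hY t ht, mem_univ _⟩) (fun t ht => ⟨hZ t ht, mem_univ _⟩) h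

theorem exists_isIntegralCurve_of_lipschitzWith [CompleteSpace E]
    (hv : ∀ t, LipschitzWith K (v t)) (hcont : ∀ y, Continuous fun t => v t y)
    (hbdd : ∀ T : ℝ, ∃ M : ℝ≥0, ∀ t ∈ Icc (-T) T, ∀ y, ‖v t y‖ ≤ M) (t₀ : ℝ) (y₀ : E) :
    ∃ Y : ℝ → E, Y t₀ = y₀ ∧ IsIntegralCurve Y v := by
  have hlocal (T : ℝ) (hT : |t₀| < T) :
      ∃ Y : ℝ → E, Y t₀ = y₀ ∧ ∀ t ∈ Ioo (-T) T, HasDerivAt Y (v t (Y t)) t :=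
    (hbdd T).elim fun _ hM => exists_eq_forall_Ioo_hasDerivAt_of_lipschitzWith hv hcont hM hT y₀
  choose! F hF₀ hF using hlocal
  have hagree {T T' t : ℝ} (hT : |t₀| < T) (hT' : |t₀| < T') (ht : |t| < T) (ht' : |t| < T') :
      F T t = F T' t := by
    refine eqOn_Ioo_of_lipschitzWith hv (a := -min T T') (b := min T T') (t₀ := t₀)
      (abs_lt.1 (lt_min hT hT')) (fun s hs => hF T hT s ?_) (fun s hs => hF T' hT' s ?_)
      ((hF₀ T hT).trans (hF₀ T' hT').symm) (abs_lt.1 (lt_min ht ht'))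
    · exact abs_lt.1 ((abs_lt.2 hs).trans_le (min_le_left _ _))
    · exact abs_lt.1 ((abs_lt.2 hs).trans_le (min_le_right _ _))
  have hinit (t : ℝ) : |t₀| < |t| + |t₀| + 1 := by linarith [abs_nonneg t]
  have hself (t : ℝ) : |t| < |t| + |t₀| + 1 := by linarith [abs_nonneg t₀]
  refine ⟨fun t => F (|t| + |t₀| + 1) t, hF₀ _ (hinit _), fun t => ?_⟩
  refine (hF _ (hinit t) t (abs_lt.1 (hself t))).congr_of_eventuallyEq ?_
  filter_upwards [(continuous_abs.tendsto t).eventually_lt_const (hself t)] with s hs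
  exact hagree (hinit s) (hinit t) (hself s) hs

theorem dist_integralCurve_le (hv : ∀ t, LipschitzWith K (v t)) {Y Z : ℝ → E}
    (hY : IsIntegralCurve Y v) (hZ : IsIntegralCurve Z v) {s t : ℝ} (hst : s ≤ t) :
    dist (Y t) (Z t) ≤ dist (Y s) (Z s) * exp (K * (t - s)) :=
  dist_le_of_trajectories_ODE hv hY.continuous.continuousOn
    (fun x _ => (hY x).hasDerivWithinAt) hZ.continuous.continuousOn
    (fun x _ => (hZ x).hasDerivWithinAt) le_rfl t (right_mem_Icc.2 hst)

theorem dist_integralCurve_le_of_le_add (hv : ∀ t, LipschitzWith K (v t)) {Y Z : ℝ → E}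
    (hY : IsIntegralCurve Y v) (hZ : IsIntegralCurve Z v) {s t T : ℝ} (hst : s ≤ t)
    (htT : t ≤ s + T) : dist (Y t) (Z t) ≤ exp (K * T) * dist (Y s) (Z s) := by
  refine (dist_integralCurve_le hv hY hZ hst).trans ?_
  rw [mul_comm]
  gcongr
  linarith

theorem continuous_integralCurve_of_initial (hv : ∀ t, LipschitzWith K (v t)) {H : E → ℝ → E}
    {s t : ℝ} (hinit : ∀ y, H y s = y) (hH : ∀ y, IsIntegralCurve (H y) v) (hst : s ≤ t) :
    Continuous fun y => H y t := by
  have hlip : LipschitzWith ⟨exp (K * (t - s)), (exp_pos _).le⟩ fun y => H y t :=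
    LipschitzWith.of_dist_le_mul fun y z => by
      have hle := dist_integralCurve_le hv (hH y) (hH z) hst
      rwa [hinit, hinit, mul_comm] at hle
  exact hlip.continuous

theorem integralCurve_comp_add_int_mul {T : ℝ} (hper : Function.Periodic v T) {V : ℝ → E}
    (hV : IsIntegralCurve V v) (n : ℤ) : IsIntegralCurve (fun t => V (t + n * T)) v := by
  have hshift := hV.comp_add (n * T)
  rwa [show v ∘ (· + n * T) = v from funext (hper.int_mul n)] at hshift

/-- Asymptotic stability of a solution `W` of `y' = v t y`, uniform in the initial time and with a
linear bound on the deviation. -/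
def IsAsymptoticallyStableSolution (v : ℝ → E → E) (W : ℝ → E) : Prop :=
  ∃ h > 0, ∃ C > 0, ∀ V, IsIntegralCurve V v → ∀ t₀, dist (V t₀) (W t₀) ≤ h →
    (∀ t, t₀ ≤ t → dist (V t) (W t) ≤ C * dist (V t₀) (W t₀)) ∧
      Tendsto (fun t => dist (V t) (W t)) atTop (𝓝 0)

/-- The time-`T` map of `y' = v t y` started at time `s` contracts towards `W` by the factor `ρ` on
the ball of radius `h`. -/
def ContractsTowards (v : ℝ → E → E) (W : ℝ → E) (T ρ h s : ℝ) : Prop :=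
  ∀ V, IsIntegralCurve V v → dist (V s) (W s) ≤ h →
    dist (V (s + T)) (W (s + T)) ≤ ρ * dist (V s) (W s)

namespace ContractsTowards

variable {W V : ℝ → E} {T ρ h s : ℝ}

theorem add_int_mul (hcon : ContractsTowards v W T ρ h s) (hper : Function.Periodic v T)
    (hW : Function.Periodic W T) (n : ℤ) : ContractsTowards v W T ρ h (s + n * T) := by
  intro V hV hclose
  have hstep := hcon _ (integralCurve_comp_add_int_mul hper hV n)
  rw [← hW.int_mul n s, ← hW.int_mul n (s + T), add_right_comm s T] at hstep
  exact hstep hclose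

theorem dist_add_nat_mul_le (hcon : ContractsTowards v W T ρ h s) (hper : Function.Periodic v T)
    (hW : Function.Periodic W T) (hρ₀ : 0 ≤ ρ) (hρ₁ : ρ ≤ 1) (hV : IsIntegralCurve V v)
    (hclose : dist (V s) (W s) ≤ h) (n : ℕ) :
    dist (V (s + n * T)) (W (s + n * T)) ≤ ρ ^ n * dist (V s) (W s) := by
  induction n with
  | zero => simp
  | succ n ih =>
    have hstill_close : dist (V (s + n * T)) (W (s + n * T)) ≤ h :=
      (ih.trans (mul_le_of_le_one_left dist_nonneg (pow_le_one₀ hρ₀ hρ₁))).trans hclose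
    have hstep := hcon.add_int_mul hper hW n V hV
    rw [Int.cast_natCast] at hstep
    rw [show s + ((n + 1 : ℕ) : ℝ) * T = s + n * T + T by push_cast; ring]
    calc _ ≤ ρ * dist (V (s + n * T)) (W (s + n * T)) := hstep hstill_close
      _ ≤ ρ * (ρ ^ n * dist (V s) (W s)) := mul_le_mul_of_nonneg_left ih hρ₀
      _ = ρ ^ (n + 1) * dist (V s) (W s) := by ring

theorem dist_le_pow_floor (hcon : ContractsTowards v W T ρ h s)
    (hv : ∀ t, LipschitzWith K (v t)) (hT : 0 < T) (hper : Function.Periodic v T)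
    (hW : IsIntegralCurve W v) (hWper : Function.Periodic W T) (hρ₀ : 0 ≤ ρ) (hρ₁ : ρ ≤ 1)
    (hV : IsIntegralCurve V v) (hclose : dist (V s) (W s) ≤ h) {t : ℝ} (ht : s ≤ t) :
    dist (V t) (W t) ≤ ρ ^ ⌊(t - s) / T⌋₊ * (exp (K * T) * dist (V s) (W s)) := by
  set n := ⌊(t - s) / T⌋₊
  have hn_le : n * T ≤ t - s :=
    (le_div_iff₀ hT).1 (Nat.floor_le (div_nonneg (sub_nonneg.2 ht) hT.le))
  have hlt_n : t - s < (n + 1) * T := (div_lt_iff₀ hT).1 (Nat.lt_floor_add_one _)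
  calc dist (V t) (W t)
      ≤ exp (K * T) * dist (V (s + n * T)) (W (s + n * T)) :=
        dist_integralCurve_le_of_le_add hv hV hW (by linarith) (by linarith)
    _ ≤ exp (K * T) * (ρ ^ n * dist (V s) (W s)) := by
        gcongr
        exact hcon.dist_add_nat_mul_le hper hWper hρ₀ hρ₁ hV hclose n
    _ = _ := by ring

theorem tendsto_dist (hcon : ContractsTowards v W T ρ h s) (hv : ∀ t, LipschitzWith K (v t))
    (hT : 0 < T) (hper : Function.Periodic v T) (hW : IsIntegralCurve W v)
    (hWper : Function.Periodic W T) (hρ₀ : 0 ≤ ρ) (hρ₁ : ρ < 1) (hV : IsIntegralCurve V v)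
    (hclose : dist (V s) (W s) ≤ h) : Tendsto (fun t => dist (V t) (W t)) atTop (𝓝 0) := by
  have hfloor : Tendsto (fun t : ℝ => ⌊(t - s) / T⌋₊) atTop atTop :=
    tendsto_nat_floor_atTop.comp
      ((tendsto_atTop_add_const_right _ (-s) tendsto_id).atTop_div_const hT)
  have hpow := ((tendsto_pow_atTop_nhds_zero_of_lt_one hρ₀ hρ₁).comp hfloor).mul_const
    (exp (K * T) * dist (V s) (W s))
  rw [zero_mul] at hpow
  refine squeeze_zero' (Eventually.of_forall fun _ => dist_nonneg) ?_ hpow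
  filter_upwards [eventually_ge_atTop s] with t ht
  exact hcon.dist_le_pow_floor hv hT hper hW hWper hρ₀ hρ₁.le hV hclose ht

theorem isAsymptoticallyStableSolution (hcon : ContractsTowards v W T ρ h s)
    (hv : ∀ t, LipschitzWith K (v t)) (hT : 0 < T) (hper : Function.Periodic v T)
    (hW : IsIntegralCurve W v) (hWper : Function.Periodic W T) (hρ₀ : 0 ≤ ρ) (hρ₁ : ρ < 1)
    (hh : 0 < h) : IsAsymptoticallyStableSolution v W := by
  set G := exp (K * T)
  have hG : 1 ≤ G := one_le_exp (by positivity)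
  refine ⟨h / G, by positivity, G * G, by positivity, fun V hV t₀ hclose => ?_⟩
  obtain ⟨n, hn⟩ : ∃ n : ℤ, t₀ ≤ s + n * T ∧ s + n * T ≤ t₀ + T := by
    have hle := (div_le_iff₀ hT).1 (Int.le_ceil ((t₀ - s) / T))
    have hlt := (lt_div_iff₀ hT).1 (sub_lt_iff_lt_add.2 (Int.ceil_lt_add_one ((t₀ - s) / T)))
    exact ⟨⌈(t₀ - s) / T⌉, by linarith, by linarith⟩
  set s' := s + n * T
  have hfirst {t : ℝ} (h₁ : t₀ ≤ t) (h₂ : t ≤ t₀ + T) :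
      dist (V t) (W t) ≤ G * dist (V t₀) (W t₀) :=
    dist_integralCurve_le_of_le_add hv hV hW h₁ h₂
  have hclose' : dist (V s') (W s') ≤ h :=
    (hfirst hn.1 hn.2).trans ((le_div_iff₀' (by positivity)).1 hclose)
  have hlater {t : ℝ} (ht : s' ≤ t) := (hcon.add_int_mul hper hWper n).dist_le_pow_floor
    hv hT hper hW hWper hρ₀ hρ₁.le hV hclose' ht
  constructor
  · intro t ht
    rcases le_total t s' with hts | hts
    · refine (hfirst ht (hts.trans hn.2)).trans ?_
      gcongr
      exact le_mul_of_one_le_left (by positivity) hG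
    · calc dist (V t) (W t) ≤ 1 * (G * dist (V s') (W s')) := by
            refine (hlater hts).trans ?_
            gcongr
            exact pow_le_one₀ hρ₀ hρ₁.le
        _ ≤ G * G * dist (V t₀) (W t₀) := by
            rw [one_mul, mul_assoc]
            gcongr
            exact hfirst hn.1 hn.2
  · exact (hcon.add_int_mul hper hWper n).tendsto_dist hv hT hper hW hWper hρ₀ hρ₁ hV hclose'

end ContractsTowards

end IntegralCurve

section RealFunction

theorem image_sub_le_of_hasDerivAt_le {f f' : ℝ → ℝ} {p s C : ℝ} (hps : p ≤ s)
    (hf : ∀ x ∈ Icc p s, HasDerivAt f (f' x) x) (hC : ∀ x ∈ Icc p s, f' x ≤ C) :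
    f s - f p ≤ C * (s - p) := by
  rcases hps.eq_or_lt with rfl | hlt
  · simp
  obtain ⟨z, hz, hslope⟩ := exists_hasDerivAt_eq_slope f f' hlt
    (fun x hx => (hf x hx).continuousAt.continuousWithinAt)
    (fun x hx => hf x (Ioo_subset_Icc_self hx))
  rw [← div_le_iff₀ (sub_pos.2 hlt), ← hslope]
  exact hC z (Ioo_subset_Icc_self hz)

theorem le_image_sub_of_le_hasDerivAt {f f' : ℝ → ℝ} {p s C : ℝ} (hps : p ≤ s)
    (hf : ∀ x ∈ Icc p s, HasDerivAt f (f' x) x) (hC : ∀ x ∈ Icc p s, C ≤ f' x) :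
    C * (s - p) ≤ f s - f p := by
  have := image_sub_le_of_hasDerivAt_le (f := fun x => -f x) (f' := fun x => -f' x) (C := -C) hps
    (fun x hx => (hf x hx).neg) (fun x hx => neg_le_neg (hC x hx))
  linarith

theorem abs_image_sub_le_of_abs_hasDerivAt_le {f f' : ℝ → ℝ} {p s C : ℝ} (hps : p ≤ s)
    (hf : ∀ x ∈ Icc p s, HasDerivAt f (f' x) x) (hC : ∀ x ∈ Icc p s, |f' x| ≤ C) :
    |f s - f p| ≤ C * (s - p) :=
  norm_image_sub_le_of_norm_deriv_le_segment' (fun x hx => (hf x hx).hasDerivWithinAt)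
    (fun x hx => hC x (Ico_subset_Icc_self hx)) s (right_mem_Icc.2 hps)

theorem exp_mul_eq_of_hasDerivAt_neg_mul {f : ℝ → ℝ} {b p s : ℝ} (hps : p ≤ s)
    (hf : ∀ x ∈ Icc p s, HasDerivAt f (-(b * f x)) x) :
    exp (b * s) * f s = exp (b * p) * f p := by
  have hderiv (x : ℝ) (hx : x ∈ Icc p s) : HasDerivAt (fun x => exp (b * x) * f x) 0 x := by
    refine (((hasDerivAt_id x).const_mul b).exp.mul (hf x hx)).congr_deriv ?_
    simp only [id_eq]
    ring
  exact constant_of_has_deriv_right_zero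
    (fun x hx => (hderiv x hx).continuousAt.continuousWithinAt)
    (fun x hx => (hderiv x (Ico_subset_Icc_self hx)).hasDerivWithinAt) s (right_mem_Icc.2 hps)

theorem exists_first_crossing {f : ℝ → ℝ} {p s e : ℝ} (hps : p ≤ s)
    (hf : ContinuousOn f (Icc p s)) (hp : e ≤ f p) (hs : f s ≤ e) :
    ∃ q ∈ Icc p s, f q = e ∧ ∀ x ∈ Icc p q, e ≤ f x := by
  have hcompact : IsCompact (Icc p s ∩ f ⁻¹' Iic e) :=
    isCompact_Icc.of_isClosed_subset (hf.preimage_isClosed_of_isClosed isClosed_Icc isClosed_Iic)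
      inter_subset_left
  obtain ⟨q, ⟨hq, hfq⟩, hleast⟩ := hcompact.exists_isLeast ⟨s, right_mem_Icc.2 hps, hs⟩
  have eq_q {x : ℝ} (hx : x ∈ Icc p q) (hfx : f x ≤ e) : x = q :=
    hx.2.antisymm (hleast ⟨⟨hx.1, hx.2.trans hq.2⟩, hfx⟩)
  obtain ⟨z, hz, hfz⟩ :=
    intermediate_value_Icc' hq.1 (hf.mono (Icc_subset_Icc_right hq.2)) ⟨hfq, hp⟩
  have hfq_eq : f q = e := eq_q hz hfz.le ▸ hfz
  refine ⟨q, hq, hfq_eq, fun x hx => ?_⟩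
  by_contra! hlt
  rw [eq_q hx hlt.le, hfq_eq] at hlt
  exact hlt.false

theorem abs_cos_sub_cos_le_mul (x y : ℝ) : |cos x - cos y| ≤ |x + y| * |x - y| / 2 := by
  have hadd : |sin ((x + y) / 2)| ≤ |(x + y) / 2| := abs_sin_le_abs
  have hsub : |sin ((x - y) / 2)| ≤ |(x - y) / 2| := abs_sin_le_abs
  rw [abs_div, abs_two] at hadd hsub
  rw [cos_sub_cos, abs_mul, abs_mul, abs_neg, abs_two]
  calc 2 * |sin ((x + y) / 2)| * |sin ((x - y) / 2)| ≤ 2 * (|x + y| / 2) * (|x - y| / 2) := by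
        gcongr
    _ = |x + y| * |x - y| / 2 := by ring

theorem two_mul_le_sin_pi_mul {t : ℝ} (h₀ : 0 ≤ t) (h₁ : t ≤ 1 / 2) : 2 * t ≤ sin (π * t) := by
  have hjordan := mul_le_sin (x := π * t) (by positivity) (by nlinarith [pi_pos])
  rwa [show 2 / π * (π * t) = 2 * t by field_simp] at hjordan

theorem two_mul_one_sub_le_sin_pi_mul {t : ℝ} (h₀ : 1 / 2 ≤ t) (h₁ : t ≤ 1) :
    2 * (1 - t) ≤ sin (π * t) := by
  have := two_mul_le_sin_pi_mul (t := 1 - t) (by linarith) (by linarith)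
  rwa [show π * (1 - t) = π - π * t by ring, sin_pi_sub] at this

theorem log_le_log_add {x y z : ℝ} (hx : 0 < x) (hy : 0 < y) (hz : 0 ≤ z)
    (h : x ≤ y * (1 + z)) : log x ≤ log y + z := by
  have hlog := log_le_log hx h
  rw [log_mul hy.ne' (by linarith)] at hlog
  linarith [log_le_sub_one_of_pos (by linarith : 0 < 1 + z)]

end RealFunction

section Transition

variable {ψ : ℝ → ℝ}

/-- A transition function that is only required to be Lipschitz with values in `[-1, 1]`, such as
the piecewise linear `v ↦ max (-1) (min 1 v)`. -/
structure IsLipschitzTransition (ψ : ℝ → ℝ) : Prop where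
  exists_lipschitzWith : ∃ K : ℝ≥0, LipschitzWith K ψ
  abs_le_one : ∀ v : ℝ, |ψ v| ≤ 1
  eq_one : ∀ v : ℝ, 1 ≤ v → ψ v = 1
  eq_neg_one : ∀ v : ℝ, v ≤ -1 → ψ v = -1

theorem IsTransition.strictMonoOn (hψ : IsTransition ψ) : StrictMonoOn ψ (Icc (-1) 1) := by
  refine strictMonoOn_of_deriv_pos (convex_Icc _ _) hψ.contDiff.continuous.continuousOn ?_
  rw [interior_Icc]
  exact fun v hv => hψ.deriv_pos v (abs_lt.2 hv)

theorem IsTransition.abs_le_one (hψ : IsTransition ψ) (v : ℝ) : |ψ v| ≤ 1 := by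
  rcases le_total 1 v with hv | hv
  · simp [hψ.eq_one v hv]
  rcases le_total v (-1) with hv' | hv'
  · simp [hψ.eq_neg_one v hv']
  have hmono := hψ.strictMonoOn.monotoneOn
  have hle := hmono ⟨hv', hv⟩ (right_mem_Icc.2 (by norm_num)) hv
  have hge := hmono (left_mem_Icc.2 (by norm_num)) ⟨hv', hv⟩ hv'
  rw [hψ.eq_one 1 le_rfl] at hle
  rw [hψ.eq_neg_one (-1) le_rfl] at hge
  exact abs_le.2 ⟨hge, hle⟩

theorem IsTransition.deriv_eq_zero_of_notMem (hψ : IsTransition ψ) {v : ℝ}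
    (hv : v ∉ Icc (-1 : ℝ) 1) : deriv ψ v = 0 := by
  rcases lt_or_ge v (-1) with hlt | hge
  · have hconst : ψ =ᶠ[𝓝 v] fun _ => -1 := by
      filter_upwards [Iio_mem_nhds hlt] with z hz using hψ.eq_neg_one z (le_of_lt hz)
    simp [hconst.deriv_eq]
  · have hgt : 1 < v := not_le.1 fun hle => hv ⟨hge, hle⟩
    have hconst : ψ =ᶠ[𝓝 v] fun _ => 1 := by
      filter_upwards [Ioi_mem_nhds hgt] with z hz using hψ.eq_one z (le_of_lt hz)
    simp [hconst.deriv_eq]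

theorem IsTransition.exists_lipschitzWith (hψ : IsTransition ψ) :
    ∃ K : ℝ≥0, LipschitzWith K ψ := by
  obtain ⟨C, hC⟩ := (isCompact_Icc (a := (-1 : ℝ)) (b := 1)).exists_bound_of_continuousOn
    (hψ.contDiff.continuous_deriv le_rfl).continuousOn
  refine ⟨C.toNNReal, lipschitzWith_of_nnnorm_deriv_le
    (hψ.contDiff.differentiable (by norm_num)) fun v => ?_⟩
  by_cases hv : v ∈ Icc (-1 : ℝ) 1
  · exact NNReal.le_toNNReal_of_coe_le (hC v hv)
  · simp [hψ.deriv_eq_zero_of_notMem hv]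

theorem IsTransition.isLipschitzTransition (hψ : IsTransition ψ) : IsLipschitzTransition ψ :=
  ⟨hψ.exists_lipschitzWith, hψ.abs_le_one, hψ.eq_one, hψ.eq_neg_one⟩

end Transition

section Forcing

theorem sin_three_mul_half (x : ℝ) :
    sin (3 * π * x / 2) = (1 + 2 * cos (π * x)) * sin (π * x / 2) := by
  rw [show 3 * π * x / 2 = 3 * (π * x / 2) by ring, sin_three_mul,
    show cos (π * x) = cos (2 * (π * x / 2)) by ring_nf, cos_two_mul]
  linear_combination (-4 * sin (π * x / 2)) * sin_sq_add_cos_sq (π * x / 2)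

theorem forcing_eq (x l : ℝ) :
    forcing x l = (1 + l) / 2 * sin (3 * π * x / 2) + (1 - l) / 2 * sin (π * x / 2) := by
  rw [sin_three_mul_half, forcing]; ring

theorem forcing_one (x : ℝ) : forcing x 1 = sin (3 * π * x / 2) := by
  rw [forcing_eq]; ring

theorem forcing_neg_one (x : ℝ) : forcing x (-1) = sin (π * x / 2) := by
  rw [forcing_eq]; ring

theorem forcing_neg (x l : ℝ) : forcing (-x) l = -forcing x l := by
  simp only [forcing, mul_neg, neg_div, cos_neg, sin_neg]

theorem forcing_periodic : Function.Periodic forcing 4 := by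
  intro x
  funext l
  rw [forcing, forcing, show π * (x + 4) = π * x + (2 : ℕ) * (2 * π) by push_cast; ring,
    show (π * x + (2 : ℕ) * (2 * π)) / 2 = π * x / 2 + 2 * π by push_cast; ring,
    cos_add_nat_mul_two_pi, sin_add_two_pi]

theorem abs_convex_comb_le {l A B M : ℝ} (hl : |l| ≤ 1) (hA : |A| ≤ M) (hB : |B| ≤ M) :
    |(1 + l) / 2 * A + (1 - l) / 2 * B| ≤ M := by
  rw [abs_le] at *
  constructor <;> nlinarith

theorem abs_forcing_le_one (x : ℝ) {l : ℝ} (hl : |l| ≤ 1) : |forcing x l| ≤ 1 := by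
  rw [forcing_eq]
  exact abs_convex_comb_le hl (abs_sin_le_one _) (abs_sin_le_one _)

theorem lipschitzWith_forcing_right (x : ℝ) : LipschitzWith 1 (forcing x) := by
  refine LipschitzWith.of_dist_le_mul fun l l' => ?_
  have hfactor : forcing x l - forcing x l' = cos (π * x) * sin (π * x / 2) * (l - l') := by
    simp only [forcing]; ring
  rw [dist_eq, dist_eq, hfactor, abs_mul, abs_mul]
  gcongr
  exact mul_le_one₀ (abs_cos_le_one _) (abs_nonneg _) (abs_sin_le_one _)

theorem continuous_forcing_left (l : ℝ) : Continuous fun x => forcing x l := by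
  unfold forcing; fun_prop

/-- The partial derivative of the forcing with respect to the phase. -/
noncomputable def forcingDeriv (x l : ℝ) : ℝ :=
  (1 + l) / 2 * (3 * π / 2 * cos (3 * π * x / 2)) + (1 - l) / 2 * (π / 2 * cos (π * x / 2))

theorem hasDerivAt_three_pi_mul_div_two (x : ℝ) :
    HasDerivAt (fun x => 3 * π * x / 2) (3 * π / 2) x := by
  simpa using ((hasDerivAt_id x).const_mul (3 * π)).div_const 2

theorem hasDerivAt_pi_mul_div_two (x : ℝ) : HasDerivAt (fun x => π * x / 2) (π / 2) x := by
  simpa using ((hasDerivAt_id x).const_mul π).div_const 2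

theorem hasDerivAt_forcing (x l : ℝ) :
    HasDerivAt (fun x => forcing x l) (forcingDeriv x l) x := by
  rw [funext fun x => forcing_eq x l]
  refine (((hasDerivAt_three_pi_mul_div_two x).sin.const_mul ((1 + l) / 2)).add
    ((hasDerivAt_pi_mul_div_two x).sin.const_mul ((1 - l) / 2))).congr_deriv ?_
  unfold forcingDeriv; ring

theorem hasDerivAt_cos_three_half (x : ℝ) :
    HasDerivAt (fun x => 2 / (3 * π) * cos (3 * π * x / 2)) (-sin (3 * π * x / 2)) x := by
  refine ((hasDerivAt_three_pi_mul_div_two x).cos.const_mul (2 / (3 * π))).congr_deriv ?_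
  field_simp

theorem hasDerivAt_cos_half (x : ℝ) :
    HasDerivAt (fun x => 2 / π * cos (π * x / 2)) (-sin (π * x / 2)) x := by
  refine ((hasDerivAt_pi_mul_div_two x).cos.const_mul (2 / π)).congr_deriv ?_
  field_simp

theorem three_pi_div_two_le_five : 3 * π / 2 ≤ 5 := by linarith [pi_lt_d2]

theorem pi_div_two_le_five : π / 2 ≤ 5 := by linarith [pi_lt_d2]

theorem abs_forcingDeriv_le (x : ℝ) {l : ℝ} (hl : |l| ≤ 1) : |forcingDeriv x l| ≤ 5 := by
  refine abs_convex_comb_le hl ?_ ?_ <;> rw [abs_mul, abs_of_pos (by positivity)]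
  · exact (mul_le_of_le_one_right (by positivity) (abs_cos_le_one _)).trans
      three_pi_div_two_le_five
  · exact (mul_le_of_le_one_right (by positivity) (abs_cos_le_one _)).trans pi_div_two_le_five

theorem abs_mul_cos_mul_sub_le {k : ℝ} (hk₀ : 0 ≤ k) (hk : k ≤ 5) (x y : ℝ) :
    |k * (cos (k * x) - cos (k * y))| ≤ 25 * |x - y| := by
  calc |k * (cos (k * x) - cos (k * y))| = k * |cos (k * x) - cos (k * y)| := by
        rw [abs_mul, abs_of_nonneg hk₀]
    _ ≤ k * |k * x - k * y| :=
        mul_le_mul_of_nonneg_left (abs_cos_sub_cos_le _ _) hk₀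
    _ = k * k * |x - y| := by rw [← mul_sub, abs_mul, abs_of_nonneg hk₀, mul_assoc]
    _ ≤ 5 * 5 * |x - y| := by gcongr
    _ = 25 * |x - y| := by norm_num

theorem abs_forcingDeriv_sub_le (x y : ℝ) {l : ℝ} (hl : |l| ≤ 1) :
    |forcingDeriv x l - forcingDeriv y l| ≤ 25 * |x - y| := by
  have hcomb : forcingDeriv x l - forcingDeriv y l =
      (1 + l) / 2 * (3 * π / 2 * (cos (3 * π / 2 * x) - cos (3 * π / 2 * y))) +
      (1 - l) / 2 * (π / 2 * (cos (π / 2 * x) - cos (π / 2 * y))) := by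
    simp only [forcingDeriv, mul_div_right_comm]; ring
  rw [hcomb]
  exact abs_convex_comb_le hl
    (abs_mul_cos_mul_sub_le (by positivity) three_pi_div_two_le_five x y)
    (abs_mul_cos_mul_sub_le (by positivity) pi_div_two_le_five x y)

theorem lipschitzWith_forcing_left {l : ℝ} (hl : |l| ≤ 1) :
    LipschitzWith 5 fun x => forcing x l :=
  lipschitzWith_of_nnnorm_deriv_le (fun x => (hasDerivAt_forcing x l).differentiableAt) fun x => by
    rw [(hasDerivAt_forcing x l).deriv]
    exact abs_forcingDeriv_le x hl

theorem exists_forcing_slope (l : ℝ) {x y : ℝ} (hxy : x < y) :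
    ∃ z ∈ Ioo x y, forcing y l - forcing x l = forcingDeriv z l * (y - x) := by
  obtain ⟨z, hz, hslope⟩ := exists_hasDerivAt_eq_slope (fun x => forcing x l) _ hxy
    (continuous_forcing_left l).continuousOn (fun z _ => hasDerivAt_forcing z l)
  exact ⟨z, hz, by rw [hslope, div_mul_cancel₀ _ (sub_pos.2 hxy).ne']⟩

end Forcing

section CrossingWindow

/-- Phases over which `f_L` is bounded below by `1 / 2000` whatever the value of the switching
variable. Every layer passage considered here takes place over this window; its right end is just
short of the zero `x = 2 / 3` of `f_L(x, 1)`. -/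
def crossingWindow : Set ℝ := Icc (3 / 10) (2 / 3 - 1 / 5000)

variable {x : ℝ}

theorem le_sin_three_half (hx : x ∈ crossingWindow) : 1 / 2000 ≤ sin (3 * π * x / 2) := by
  have hx₀ : 3 / 10 ≤ x := hx.1
  have hx₁ : x ≤ 2 / 3 - 1 / 5000 := hx.2
  rw [show 3 * π * x / 2 = π * (3 * x / 2) by ring]
  rcases le_total (3 * x / 2) (1 / 2) with h | h
  · linarith [two_mul_le_sin_pi_mul (t := 3 * x / 2) (by linarith) h]
  · linarith [two_mul_one_sub_le_sin_pi_mul (t := 3 * x / 2) h (by linarith)]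

theorem le_sin_half (h₀ : 0 ≤ x) (h₁ : x ≤ 1) : x ≤ sin (π * x / 2) := by
  rw [show π * x / 2 = π * (x / 2) by ring]
  linarith [two_mul_le_sin_pi_mul (t := x / 2) (by linarith) (by linarith)]

theorem le_forcing (hx : x ∈ crossingWindow) {l : ℝ} (hl : |l| ≤ 1) : 1 / 2000 ≤ forcing x l := by
  have hsin₃ := le_sin_three_half hx
  have hsin₁ := le_sin_half (x := x) (by linarith [hx.1]) (by linarith [hx.2])
  have hl' := abs_le.1 hl
  rw [forcing_eq]
  nlinarith [hx.1]

theorem le_one_add_two_cos (hx : x ∈ crossingWindow) : 1 / 2000 ≤ 1 + 2 * cos (π * x) := by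
  have hsin₃ := le_sin_three_half hx
  have hsin₁ := le_sin_half (x := x) (by linarith [hx.1]) (by linarith [hx.2])
  have hsin_le := sin_le_one (π * x / 2)
  rw [sin_three_mul_half] at hsin₃
  by_contra! hlt
  nlinarith [hx.1]

theorem le_cos_three_half_sub {x y : ℝ} (hx : 1 / 3 ≤ x) (hxy : x ≤ y) (hy : y ≤ 2 / 3) :
    9 / 2 * ((2 / 3 - x) ^ 2 - (2 / 3 - y) ^ 2) ≤
      cos (3 * π * x / 2) - cos (3 * π * y / 2) := by
  have hsin_add := two_mul_one_sub_le_sin_pi_mul (t := 3 * (x + y) / 4) (by linarith)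
    (by linarith)
  have hsin_sub := two_mul_le_sin_pi_mul (t := 3 * (y - x) / 4) (by linarith) (by linarith)
  rw [cos_sub_cos, show (3 * π * x / 2 + 3 * π * y / 2) / 2 = π * (3 * (x + y) / 4) by ring,
    show (3 * π * x / 2 - 3 * π * y / 2) / 2 = -(π * (3 * (y - x) / 4)) by ring, sin_neg]
  nlinarith [mul_le_mul hsin_add hsin_sub (by linarith) (by linarith)]

theorem le_cos_half_sub {x y : ℝ} (hx : 3 / 5 ≤ x) (hx' : x ≤ 2 / 3) (hxy : x ≤ y) (hy : y ≤ 2) :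
    3 / 5 * (y - x) ≤ cos (π * x / 2) - cos (π * y / 2) := by
  have hsum : 3 / 5 ≤ sin (π * ((x + y) / 4)) := by
    rcases le_total ((x + y) / 4) (1 / 2) with hle | hge
    · linarith [two_mul_le_sin_pi_mul (by linarith) hle]
    · linarith [two_mul_one_sub_le_sin_pi_mul hge (by linarith)]
  have hdiff := two_mul_le_sin_pi_mul (t := (y - x) / 4) (by linarith) (by linarith)
  rw [cos_sub_cos, show (π * x / 2 + π * y / 2) / 2 = π * ((x + y) / 4) by ring,
    show (π * x / 2 - π * y / 2) / 2 = -(π * ((y - x) / 4)) by ring, sin_neg]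
  linarith [mul_le_mul hsum hdiff (by linarith) (by linarith)]

theorem sin_half_le_sin_half {x y : ℝ} (hx : 0 ≤ x) (hxy : x ≤ y) (hy : y ≤ 1) :
    sin (π * x / 2) ≤ sin (π * y / 2) := by
  have := pi_pos
  apply sin_le_sin_of_le_of_le_pi_div_two <;> nlinarith

theorem cos_pi_mul_le_cos_pi_mul {x y : ℝ} (hx : 0 ≤ x) (hxy : x ≤ y) (hy : y ≤ 1) :
    cos (π * y) ≤ cos (π * x) := by
  have := pi_pos
  apply cos_le_cos_of_nonneg_of_le_pi <;> nlinarith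

end CrossingWindow

section LinearDamping

variable {E : Type*} [NormedAddCommGroup E] [NormedSpace ℝ E]

theorem lipschitzWith_smul_comp_inv_smul {f : E → E} {L : ℝ≥0} (hf : LipschitzWith L f) {k : ℝ}
    (hk : k ≠ 0) : LipschitzWith L fun u => k • f (k⁻¹ • u) := by
  refine ((lipschitzWith_smul k).comp (hf.comp (lipschitzWith_smul k⁻¹))).weaken (le_of_eq ?_)
  rw [nnnorm_inv, mul_left_comm, mul_inv_cancel₀ (nnnorm_ne_zero_iff.2 hk), mul_one]

/- In the unknown `exp (b * t) • y` the linear term disappears and the field is bounded on bounded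
time intervals. -/
theorem exists_isIntegralCurve_neg_smul_add [CompleteSpace E] {g : ℝ → E → E} {L M : ℝ≥0}
    (hg : ∀ t, LipschitzWith L (g t)) (hcont : ∀ y, Continuous fun t => g t y)
    (hM : ∀ t y, ‖g t y‖ ≤ M) (b t₀ : ℝ) (y₀ : E) :
    ∃ Y : ℝ → E, Y t₀ = y₀ ∧ IsIntegralCurve Y fun t y => -(b • y) + g t y := by
  have hjoint : Continuous fun p : ℝ × E => g p.1 p.2 :=
    continuous_prod_of_continuous_lipschitzWith' _ L hg hcont
  have hexp : Continuous fun t => exp (b * t) := by fun_prop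
  obtain ⟨U, hU₀, hU⟩ := exists_isIntegralCurve_of_lipschitzWith
    (v := fun t u => exp (b * t) • g t ((exp (b * t))⁻¹ • u))
    (fun t => lipschitzWith_smul_comp_inv_smul (hg t) (exp_ne_zero _))
    (fun u => hexp.smul (hjoint.comp (continuous_id.prodMk
      ((hexp.inv₀ fun _ => exp_ne_zero _).smul continuous_const))))
    (fun T => ⟨⟨exp (|b| * T), (exp_pos _).le⟩ * M, fun t ht u => by
      rw [norm_smul, norm_of_nonneg (exp_pos _).le]
      refine mul_le_mul (exp_le_exp.2 ?_) (hM _ _) (norm_nonneg _) (exp_pos _).le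
      exact (le_abs_self _).trans ((abs_mul _ _).trans_le
        (mul_le_mul_of_nonneg_left (abs_le.2 ht) (abs_nonneg b)))⟩)
    t₀ (exp (b * t₀) • y₀)
  refine ⟨fun t => (exp (b * t))⁻¹ • U t, ?_, fun t => ?_⟩
  · simp only [hU₀, inv_smul_smul₀ (exp_ne_zero _)]
  · have hderiv : HasDerivAt (fun t => (exp (b * t))⁻¹) (-b * (exp (b * t))⁻¹) t := by
      simp only [← exp_neg, ← neg_mul]
      exact ((hasDerivAt_id t).const_mul (-b)).exp.congr_deriv (by simp [mul_comm])
    refine (hderiv.smul (hU t)).congr_deriv ?_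
    simp only [inv_smul_smul₀ (exp_ne_zero _), mul_smul, neg_smul]
    abel

end LinearDamping

section ScalarEquation

variable {ψ : ℝ → ℝ} {b ε : ℝ} {Y Z : ℝ → ℝ}

/-- The right-hand side of `dy/dx = -b y - f_L(x, ψ(y / ε))`, the equation of the regularized
system for `y = ε v` as a function of the phase `x`. The damping `b` may have either sign. -/
noncomputable def scalarField (ψ : ℝ → ℝ) (b ε x y : ℝ) : ℝ :=
  -(b * y) - forcing x (ψ (y / ε))

/-- A global solution of the scalar equation. -/
abbrev IsSol (ψ : ℝ → ℝ) (b ε : ℝ) (Y : ℝ → ℝ) : Prop :=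
  IsIntegralCurve Y (scalarField ψ b ε)

theorem periodic_scalarField : Function.Periodic (scalarField ψ b ε) 4 := fun x => by
  funext y
  simp only [scalarField, forcing_periodic x]

theorem IsLipschitzTransition.exists_lipschitzWith_forcing (hψ : IsLipschitzTransition ψ) (ε : ℝ) :
    ∃ L : ℝ≥0, ∀ x, LipschitzWith L fun y => forcing x (ψ (y / ε)) := by
  obtain ⟨C, hC⟩ := hψ.exists_lipschitzWith
  refine ⟨1 * (C * ‖ε⁻¹‖₊), fun x => ?_⟩
  simp only [div_eq_inv_mul]
  exact (lipschitzWith_forcing_right x).comp (hC.comp (lipschitzWith_smul ε⁻¹))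

theorem IsLipschitzTransition.exists_lipschitzWith_scalarField (hψ : IsLipschitzTransition ψ)
    (b ε : ℝ) : ∃ K : ℝ≥0, ∀ x, LipschitzWith K (scalarField ψ b ε x) := by
  obtain ⟨L, hL⟩ := hψ.exists_lipschitzWith_forcing ε
  exact ⟨‖b‖₊ + L, fun x => (lipschitzWith_smul b).neg.sub (hL x)⟩

theorem IsLipschitzTransition.exists_isSol (hψ : IsLipschitzTransition ψ) (b ε x₀ y₀ : ℝ) :
    ∃ Y, Y x₀ = y₀ ∧ IsSol ψ b ε Y := by
  obtain ⟨L, hL⟩ := hψ.exists_lipschitzWith_forcing ε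
  obtain ⟨Y, hY₀, hY⟩ := exists_isIntegralCurve_neg_smul_add
    (g := fun x y => -forcing x (ψ (y / ε))) (fun x => (hL x).neg)
    (fun y => (continuous_forcing_left _).neg) (M := 1)
    (fun x y => (norm_neg _).trans_le (abs_forcing_le_one x (hψ.abs_le_one _))) b x₀ y₀
  exact ⟨Y, hY₀, fun x => (hY x).congr_deriv (sub_eq_add_neg _ _).symm⟩

namespace IsSol

theorem comp_neg (hY : IsSol ψ b ε Y) : IsSol ψ (-b) ε fun x => Y (-x) := fun x => by
  refine ((hY (-x)).scomp x (hasDerivAt_neg x)).congr_deriv ?_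
  simp only [scalarField, forcing_neg, smul_eq_mul]
  ring

theorem eq_of_eq_at (hψ : IsLipschitzTransition ψ) (hY : IsSol ψ b ε Y) (hZ : IsSol ψ b ε Z)
    {x₀ : ℝ} (h : Y x₀ = Z x₀) : Y = Z := by
  obtain ⟨K, hK⟩ := hψ.exists_lipschitzWith_scalarField b ε
  exact ODE_solution_unique_univ (s := fun _ => univ) (fun x => (hK x).lipschitzOnWith)
    (fun x => ⟨hY x, mem_univ _⟩) (fun x => ⟨hZ x, mem_univ _⟩) h

theorem lt_of_lt_at (hψ : IsLipschitzTransition ψ) (hY : IsSol ψ b ε Y) (hZ : IsSol ψ b ε Z)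
    {x₀ : ℝ} (h : Y x₀ < Z x₀) (x : ℝ) : Y x < Z x := by
  by_contra! hle
  have hcont : Continuous fun x => Z x - Y x := hZ.continuous.sub hY.continuous
  obtain ⟨z, hz⟩ := mem_range_of_exists_le_of_exists_ge hcont (c := 0)
    ⟨x, sub_nonpos.2 hle⟩ ⟨x₀, sub_nonneg.2 h.le⟩
  exact h.ne (congrFun (hY.eq_of_eq_at hψ hZ (sub_eq_zero.1 hz).symm) x₀)

end IsSol

end ScalarEquation

section HalfOrbit

variable {ψ : ℝ → ℝ} {b ε : ℝ} {Y : ℝ → ℝ} {p q r s x y : ℝ}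

theorem scalarField_of_le (hψ : IsLipschitzTransition ψ) (hε : 0 < ε) (hy : ε ≤ y) :
    scalarField ψ b ε x y = -(b * y) - sin (3 * π * x / 2) := by
  rw [scalarField, hψ.eq_one _ ((one_le_div hε).2 hy), forcing_one]

theorem scalarField_of_le_neg (hψ : IsLipschitzTransition ψ) (hε : 0 < ε) (hy : y ≤ -ε) :
    scalarField ψ b ε x y = -(b * y) - sin (π * x / 2) := by
  rw [scalarField, hψ.eq_neg_one _ ((div_le_iff₀ hε).2 (by rwa [neg_one_mul])), forcing_neg_one]

theorem scalarField_le_neg (hψ : IsLipschitzTransition ψ) (hby : |b * y| ≤ 1 / 4000)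
    (hx : x ∈ crossingWindow) : scalarField ψ b ε x y ≤ -(1 / 4000) := by
  have hforcing := le_forcing hx (hψ.abs_le_one (y / ε))
  rw [scalarField]
  linarith [neg_abs_le (b * y)]

theorem IsSol.abs_le_three (hψ : IsLipschitzTransition ψ) (hb : |b| ≤ 1 / 20)
    (hY : IsSol ψ b ε Y) (h₀ : |Y 0| ≤ 1 / 2) (hx : x ∈ Icc 0 2) : |Y x| ≤ 3 := by
  have hgrowth (t : ℝ) : ‖scalarField ψ b ε t (Y t)‖ ≤ 1 / 20 * ‖Y t‖ + 1 := by
    refine (abs_sub _ _).trans (add_le_add ?_ (abs_forcing_le_one t (hψ.abs_le_one _)))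
    rw [abs_neg, abs_mul]
    exact mul_le_mul_of_nonneg_right hb (abs_nonneg _)
  have hgronwall := norm_le_gronwallBound_of_norm_deriv_right_le (δ := 1 / 2) (a := 0) (b := 2)
    hY.continuous.continuousOn (fun t _ => (hY t).hasDerivWithinAt) h₀ (fun t _ => hgrowth t) x hx
  rw [gronwallBound_of_K_ne_0 (by norm_num), norm_eq_abs] at hgronwall
  have hexp : exp (1 / 20 * (x - 0)) ≤ 10 / 9 :=
    calc exp (1 / 20 * (x - 0)) ≤ exp (1 / 10) := exp_le_exp.2 (by linarith [hx.2])
      _ ≤ 1 / (1 - 1 / 10) := exp_bound_div_one_sub_of_interval (by norm_num) (by norm_num)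
      _ = 10 / 9 := by norm_num
  linarith

theorem IsSol.abs_sub_above_le (hψ : IsLipschitzTransition ψ) (hε : 0 < ε) (hY : IsSol ψ b ε Y)
    (hps : p ≤ s) (habove : ∀ x ∈ Icc p s, ε ≤ Y x) {M : ℝ} (hM : ∀ x ∈ Icc p s, |Y x| ≤ M) :
    |Y s - Y p - 2 / (3 * π) * (cos (3 * π * s / 2) - cos (3 * π * p / 2))| ≤
      |b| * M * (s - p) := by
  have hbound := abs_image_sub_le_of_abs_hasDerivAt_le hps
    (fun x _ => (hY x).sub (hasDerivAt_cos_three_half x)) (C := |b| * M) fun x hx => by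
      rw [scalarField_of_le hψ hε (habove x hx), sub_neg_eq_add, sub_add_cancel, abs_neg, abs_mul]
      exact mul_le_mul_of_nonneg_left (hM x hx) (abs_nonneg b)
  rwa [Pi.sub_apply, Pi.sub_apply, sub_sub_sub_comm, ← mul_sub] at hbound

theorem IsSol.abs_sub_below_le (hψ : IsLipschitzTransition ψ) (hε : 0 < ε) (hY : IsSol ψ b ε Y)
    (hps : p ≤ s) (hbelow : ∀ x ∈ Icc p s, Y x ≤ -ε) {M : ℝ} (hM : ∀ x ∈ Icc p s, |Y x| ≤ M) :
    |Y s - Y p - 2 / π * (cos (π * s / 2) - cos (π * p / 2))| ≤ |b| * M * (s - p) := by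
  have hbound := abs_image_sub_le_of_abs_hasDerivAt_le hps
    (fun x _ => (hY x).sub (hasDerivAt_cos_half x)) (C := |b| * M) fun x hx => by
      rw [scalarField_of_le_neg hψ hε (hbelow x hx), sub_neg_eq_add, sub_add_cancel, abs_neg,
        abs_mul]
      exact mul_le_mul_of_nonneg_left (hM x hx) (abs_nonneg b)
  rwa [Pi.sub_apply, Pi.sub_apply, sub_sub_sub_comm, ← mul_sub] at hbound

theorem IsSol.sub_le_of_mem_crossingWindow (hψ : IsLipschitzTransition ψ) (hY : IsSol ψ b ε Y)
    (hps : p ≤ s) (hp : p ∈ crossingWindow) (hs : s ∈ crossingWindow)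
    (hbY : ∀ x ∈ Icc p s, |b * Y x| ≤ 1 / 4000) : Y s - Y p ≤ -(1 / 4000) * (s - p) :=
  image_sub_le_of_hasDerivAt_le hps (fun x _ => hY x)
    fun x hx => scalarField_le_neg hψ (hbY x hx) ⟨hp.1.trans hx.1, hx.2.trans hs.2⟩

/-- The range of parameters for which the estimates are carried out. The bounds are far from
optimal. -/
structure IsAdmissible (ψ : ℝ → ℝ) (b ε : ℝ) : Prop where
  transition : IsLipschitzTransition ψ
  eps_pos : 0 < ε
  eps_le : ε ≤ 1 / 10 ^ 30
  abs_damping_le : |b| ≤ 1 / 10 ^ 30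

/-- The part over `0 ≤ x ≤ 2` of a crossing orbit: it stays above the layer on `[0, q]`, traverses
it downwards on `[q, r]`, and stays below it on `[r, 2]`. -/
structure HalfOrbit (ψ : ℝ → ℝ) (b ε : ℝ) (Y : ℝ → ℝ) (q r : ℝ) : Prop
    extends IsAdmissible ψ b ε where
  isSol : IsSol ψ b ε Y
  le_entry : 3 / 10 ≤ q
  entry_le_exit : q ≤ r
  exit_le : r ≤ 2 / 3 - 1 / 5000
  above : ∀ x ∈ Icc 0 q, ε ≤ Y x
  below : ∀ x ∈ Icc r 2, Y x ≤ -ε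
  at_entry : Y q = ε
  at_exit : Y r = -ε
  abs_le_three : ∀ x ∈ Icc (0 : ℝ) 2, |Y x| ≤ 3

/-- The initial value for which the undamped motion `2 / (3π) * cos (3πx/2)` above the layer reaches
`y = 0` at `x = 1/3`. -/
noncomputable def initialLow : ℝ := 2 / (3 * π)

/-- The initial value for which the undamped motion above the layer reaches `y = 0` at
`x = 2/3 - 1/2000`, just before the phase `2/3` after which it would turn back. -/
noncomputable def initialHigh : ℝ := 2 / (3 * π) * (1 - cos (3 * π * (2 / 3 - 1 / 2000) / 2))

theorem two_div_three_pi_mem : 2 / (3 * π) ∈ Icc (1 / 6 : ℝ) (1 / 4) := by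
  constructor
  · rw [le_div_iff₀ (by positivity)]; linarith [pi_lt_d2]
  · rw [div_le_iff₀ (by positivity)]; linarith [pi_gt_three]

theorem le_two_div_pi : 6 / 10 ≤ 2 / π := by
  rw [le_div_iff₀ pi_pos]; linarith [pi_lt_d2]

theorem initialHigh_le : initialHigh ≤ 1 / 2 := by
  have hcos := neg_one_le_cos (3 * π * (2 / 3 - 1 / 2000) / 2)
  have hcoef := two_div_three_pi_mem
  rw [initialHigh]
  nlinarith [hcoef.1, hcoef.2]

theorem initialLow_le_initialHigh : initialLow ≤ initialHigh := by
  have hcos : cos (3 * π * (2 / 3 - 1 / 2000) / 2) ≤ 0 :=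
    cos_nonpos_of_pi_div_two_le_of_le (by linarith [pi_pos]) (by linarith [pi_pos])
  exact le_mul_of_one_le_right (two_div_three_pi_mem.1.trans' (by norm_num)) (by linarith)

namespace IsAdmissible

theorem neg (h : IsAdmissible ψ b ε) : IsAdmissible ψ (-b) ε :=
  ⟨h.transition, h.eps_pos, h.eps_le, (abs_neg b).trans_le h.abs_damping_le⟩

theorem abs_damping_mul_le (h : IsAdmissible ψ b ε) (hy : |y| ≤ 3) : |b * y| ≤ 1 / 4000 := by
  rw [abs_mul]
  exact (mul_le_mul h.abs_damping_le hy (abs_nonneg _) (by norm_num)).trans (by norm_num)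

theorem exists_entry (h : IsAdmissible ψ b ε) (hY : IsSol ψ b ε Y)
    (habs : ∀ x ∈ Icc 0 2, |Y x| ≤ 3) (hε : ε ≤ Y 0) (hhigh : Y 0 ≤ initialHigh) :
    ∃ q ∈ Icc 0 (2 / 3 - 1 / 4000), Y q = ε ∧ ∀ x ∈ Icc 0 q, ε ≤ Y x := by
  by_cases! hreach : ∃ s ∈ Icc (0 : ℝ) (2 / 3 - 1 / 4000), Y s ≤ ε
  · obtain ⟨s, hs, hYs⟩ := hreach
    obtain ⟨q, hq, hYq⟩ := exists_first_crossing hs.1 hY.continuous.continuousOn hε hYs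
    exact ⟨q, ⟨hq.1, hq.2.trans hs.2⟩, hYq⟩
  exfalso
  have hmotion := hY.abs_sub_above_le h.transition h.eps_pos (p := 0) (s := 2 / 3 - 1 / 4000)
    (by norm_num) (fun x hx => (hreach x hx).le)
    (fun x hx => habs x ⟨hx.1, hx.2.trans (by norm_num)⟩)
  have hdrop := le_cos_three_half_sub (x := 2 / 3 - 1 / 2000) (y := 2 / 3 - 1 / 4000) (by norm_num)
    (by norm_num) (by norm_num)
  have hdrop' := mul_le_mul_of_nonneg_right hdrop
    (two_div_three_pi_mem.1.trans' (by norm_num))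
  rw [mul_zero, zero_div, cos_zero] at hmotion
  rw [initialHigh] at hhigh
  linarith [(abs_le.1 hmotion).2, hreach (2 / 3 - 1 / 4000) ⟨by norm_num, le_rfl⟩, h.eps_pos,
    h.abs_damping_le, two_div_three_pi_mem.1]

theorem le_entry (h : IsAdmissible ψ b ε) (hY : IsSol ψ b ε Y)
    (habs : ∀ x ∈ Icc 0 2, |Y x| ≤ 3) (hlow : initialLow ≤ Y 0) (hq : 0 ≤ q) (hYq : Y q = ε)
    (habove : ∀ x ∈ Icc 0 q, ε ≤ Y x) : 3 / 10 ≤ q := by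
  by_contra! hlt
  have hmotion := hY.abs_sub_above_le h.transition h.eps_pos hq habove
    (fun x hx => habs x ⟨hx.1, hx.2.trans (by linarith)⟩)
  have hanti : cos (3 * π * (3 / 10) / 2) ≤ cos (3 * π * q / 2) :=
    cos_le_cos_of_nonneg_of_le_pi (by positivity) (by linarith [pi_pos]) (by gcongr)
  have hsin := two_mul_le_sin_pi_mul (t := 1 / 20) (by norm_num) (by norm_num)
  rw [show π * (1 / 20) = π / 2 - 3 * π * (3 / 10) / 2 by ring, sin_pi_div_two_sub] at hsin
  have hcos := mul_le_mul two_div_three_pi_mem.1 (hsin.trans hanti) (by norm_num)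
    (two_div_three_pi_mem.1.trans' (by norm_num))
  rw [mul_zero, zero_div, cos_zero, hYq] at hmotion
  rw [initialLow] at hlow
  have hdamping : |b| * 3 * (q - 0) ≤ 1 / 10 ^ 30 * 3 * 1 := by
    gcongr
    · exact h.abs_damping_le
    · linarith
  linarith [(abs_le.1 hmotion).1, h.eps_le]

theorem sub_le (h : IsAdmissible ψ b ε) (hY : IsSol ψ b ε Y) (habs : ∀ x ∈ Icc 0 2, |Y x| ≤ 3)
    (hxy : x ≤ y) (hx : x ∈ crossingWindow) (hy : y ∈ crossingWindow) :
    Y y - Y x ≤ -(1 / 4000) * (y - x) :=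
  hY.sub_le_of_mem_crossingWindow h.transition hxy hx hy fun z hz =>
    h.abs_damping_mul_le (habs z ⟨by linarith [hx.1, hz.1], by linarith [hy.2, hz.2]⟩)

theorem at_window_end_lt (h : IsAdmissible ψ b ε) (hY : IsSol ψ b ε Y)
    (habs : ∀ x ∈ Icc 0 2, |Y x| ≤ 3) (hq : 3 / 10 ≤ q) (hq' : q ≤ 2 / 3 - 1 / 4000)
    (hYq : Y q = ε) : Y (2 / 3 - 1 / 5000) < -ε := by
  have hfall := h.sub_le hY habs (x := q) (y := 2 / 3 - 1 / 5000) (by linarith)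
    ⟨hq, by linarith⟩ ⟨by norm_num, le_rfl⟩
  linarith [h.eps_le]

theorem below_after_window (h : IsAdmissible ψ b ε) (hY : IsSol ψ b ε Y)
    (habs : ∀ x ∈ Icc 0 2, |Y x| ≤ 3) (hend : Y (2 / 3 - 1 / 5000) < -ε)
    (hx : x ∈ Icc (2 / 3 - 1 / 5000) 2) : Y x ≤ -ε := by
  by_contra! hreturn
  obtain ⟨s, hs, hYs, hbelow⟩ := exists_first_crossing (f := fun x => -Y x) (e := ε) hx.1
    hY.continuous.neg.continuousOn (by linarith) (by linarith)
  have hs₂ : s ≤ 2 := hs.2.trans hx.2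
  have hmotion := hY.abs_sub_below_le h.transition h.eps_pos hs.1
    (fun z hz => le_neg_of_le_neg (hbelow z hz))
    (fun z hz => habs z ⟨by linarith [hz.1], hz.2.trans hs₂⟩)
  have hdrop := le_cos_half_sub (x := 2 / 3 - 1 / 5000) (by norm_num) (by norm_num) hs.1 hs₂
  have hfall := mul_le_mul le_two_div_pi hdrop (by linarith [hs.1]) (by positivity)
  have hdamping : |b| * 3 * (s - (2 / 3 - 1 / 5000)) ≤ 1 / 10 * (s - (2 / 3 - 1 / 5000)) :=
    mul_le_mul_of_nonneg_right (by linarith [h.abs_damping_le]) (sub_nonneg.2 hs.1)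
  linarith [(abs_le.1 hmotion).2, hs.1]

theorem exists_halfOrbit (h : IsAdmissible ψ b ε) (hY : IsSol ψ b ε Y)
    (h₀ : Y 0 ∈ Icc initialLow initialHigh) : ∃ q r, HalfOrbit ψ b ε Y q r := by
  have hlow : 1 / 6 ≤ Y 0 := two_div_three_pi_mem.1.trans h₀.1
  have hε : ε ≤ Y 0 := by linarith [h.eps_le]
  have habs (x : ℝ) (hx : x ∈ Icc 0 2) : |Y x| ≤ 3 :=
    hY.abs_le_three h.transition (by linarith [h.abs_damping_le])
      (abs_le.2 ⟨by linarith, h₀.2.trans initialHigh_le⟩) hx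
  obtain ⟨q, ⟨hq₀, hq₁⟩, hYq, habove⟩ := h.exists_entry hY habs hε h₀.2
  have hq := h.le_entry hY habs h₀.1 hq₀ hYq habove
  have hend := h.at_window_end_lt hY habs hq hq₁ hYq
  obtain ⟨r, ⟨hqr, hr⟩, hYr⟩ := intermediate_value_Icc' (a := q) (b := 2 / 3 - 1 / 5000)
    (by linarith) hY.continuous.continuousOn ⟨hend.le, by linarith [h.eps_pos]⟩
  refine ⟨q, r, h, hY, hq, hqr, hr, habove, fun x hx => ?_, hYq, hYr, habs⟩
  rcases le_total x (2 / 3 - 1 / 5000) with hle | hge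
  · linarith [h.sub_le hY habs hx.1 ⟨hq.trans hqr, hr⟩ ⟨(hq.trans hqr).trans hx.1, hle⟩, hx.1]
  · exact h.below_after_window hY habs hend ⟨hge, hx.2⟩

end IsAdmissible

end HalfOrbit

section RealFunctionOnInterval

variable {f f' : ℝ → ℝ} {p s : ℝ}

theorem exists_continuousOn_rightInverse_of_mul_sub_le {c : ℝ} (hc : 0 < c) (hps : p ≤ s)
    (hf : ContinuousOn f (Icc p s))
    (hexp : ∀ x ∈ Icc p s, ∀ y ∈ Icc p s, x ≤ y → c * (y - x) ≤ f x - f y) :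
    ∃ g, ContinuousOn g (Icc (f s) (f p)) ∧ MapsTo g (Icc (f s) (f p)) (Icc p s) ∧
      ∀ v ∈ Icc (f s) (f p), f (g v) = v := by
  have hsurj (v : ℝ) (hv : v ∈ Icc (f s) (f p)) : ∃ x ∈ Icc p s, f x = v :=
    intermediate_value_Icc' hps hf hv
  choose! g hmem hg using hsurj
  refine ⟨g, ?_, hmem, hg⟩
  refine (LipschitzOnWith.of_dist_le_mul (K := c⁻¹.toNNReal) fun v hv w hw => ?_).continuousOn
  rw [coe_toNNReal _ (by positivity), ← div_eq_inv_mul, le_div_iff₀' hc, dist_eq, dist_eq]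
  rcases le_total (g v) (g w) with hle | hle
  · have := hexp _ (hmem v hv) _ (hmem w hw) hle
    rw [hg v hv, hg w hw] at this
    rw [abs_of_nonpos (sub_nonpos.2 hle)]
    linarith [le_abs_self (v - w)]
  · have := hexp _ (hmem w hw) _ (hmem v hv) hle
    rw [hg v hv, hg w hw] at this
    rw [abs_of_nonneg (sub_nonneg.2 hle)]
    linarith [neg_abs_le (v - w)]

theorem abs_image_sub_le_of_abs_hasDerivAt_Ioo_le {C : ℝ} (hps : p ≤ s)
    (hf : ContinuousOn f (Icc p s)) (hf' : ∀ x ∈ Ioo p s, HasDerivAt f (f' x) x)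
    (hC : ∀ x ∈ Ioo p s, |f' x| ≤ C) : |f s - f p| ≤ C * (s - p) := by
  rcases hps.eq_or_lt with rfl | hlt
  · simp
  obtain ⟨z, hz, hslope⟩ := exists_hasDerivAt_eq_slope f f' hlt hf hf'
  rw [← div_le_iff₀ (sub_pos.2 hlt), ← abs_of_pos (sub_pos.2 hlt), ← abs_div, ← hslope]
  exact hC z hz

theorem abs_image_sub_le_of_abs_hasDerivAt_le_mul_add {k β x : ℝ} (hk : 0 ≤ k)
    (hkps : k * (s - p) ≤ 1 / 2) (hβ : 0 ≤ β) (hf : ContinuousOn f (Icc p s))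
    (hf' : ∀ x ∈ Ioo p s, HasDerivAt f (f' x) x) (hbound : ∀ x ∈ Ioo p s, |f' x| ≤ k * (|f x| + β))
    (hx : x ∈ Icc p s) : |f x - f s| ≤ 2 * k * (s - p) * (|f s| + β) := by
  obtain ⟨m, hm, hmax⟩ := isCompact_Icc.exists_isMaxOn ⟨x, hx⟩ hf.abs
  have habs (z : ℝ) (hz : z ∈ Icc p s) : |f z| ≤ |f m| := hmax hz
  have hvariation (z : ℝ) (hz : z ∈ Icc p s) : |f z - f s| ≤ k * (s - p) * (|f m| + β) := by
    have hmvt := abs_image_sub_le_of_abs_hasDerivAt_Ioo_le (C := k * (|f m| + β)) hz.2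
      (hf.mono (Icc_subset_Icc_left hz.1)) (fun w hw => hf' w ⟨hz.1.trans_lt hw.1, hw.2⟩)
      fun w hw => by
        have hw' : w ∈ Ioo p s := ⟨hz.1.trans_lt hw.1, hw.2⟩
        exact (hbound w hw').trans (mul_le_mul_of_nonneg_left
          (add_le_add_left (habs w (Ioo_subset_Icc_self hw')) β) hk)
    rw [abs_sub_comm]
    calc |f s - f z| ≤ k * (|f m| + β) * (s - z) := hmvt
      _ ≤ k * (|f m| + β) * (s - p) := by gcongr; exact hz.1
      _ = k * (s - p) * (|f m| + β) := by ring
  have hmax_le : |f m| + β ≤ 2 * (|f s| + β) := by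
    have := mul_le_mul_of_nonneg_right hkps (by positivity : 0 ≤ |f m| + β)
    linarith [hvariation m hm, abs_sub_abs_le_abs_sub (f m) (f s)]
  calc |f x - f s| ≤ k * (s - p) * (|f m| + β) := hvariation x hx
    _ ≤ k * (s - p) * (2 * (|f s| + β)) := by
        gcongr
        exact mul_nonneg hk (sub_nonneg.2 (hx.1.trans hx.2))
    _ = 2 * k * (s - p) * (|f s| + β) := by ring

end RealFunctionOnInterval

section Layer

variable {ψ : ℝ → ℝ} {b c ε v x y q r : ℝ} {X X₁ X₂ V₁ V₂ Y Y₁ Y₂ : ℝ → ℝ}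

/-- The downward speed `-dy/dx` inside the layer, as a function of the phase `x` and of
`v = y / ε`. -/
noncomputable def layerSpeed (ψ : ℝ → ℝ) (b ε x v : ℝ) : ℝ := forcing x (ψ v) + b * ε * v

theorem scalarField_mul (hε : ε ≠ 0) :
    scalarField ψ b ε x (ε * v) = -layerSpeed ψ b ε x v := by
  rw [scalarField, layerSpeed, mul_div_cancel_left₀ _ hε]
  ring

namespace IsAdmissible

theorem layerSpeed_mem (h : IsAdmissible ψ b ε) (hx : x ∈ crossingWindow) (hv : |v| ≤ 1) :
    layerSpeed ψ b ε x v ∈ Icc (1 / 4000) 2 := by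
  have hlower := le_forcing hx (h.transition.abs_le_one v)
  have hupper := (abs_le.1 (abs_forcing_le_one x (h.transition.abs_le_one v))).2
  have hdamping : |b * ε * v| ≤ 1 / 10 ^ 30 * (1 / 10 ^ 30) * 1 := by
    rw [abs_mul, abs_mul, abs_of_pos h.eps_pos]
    gcongr
    exacts [h.eps_pos.le, h.abs_damping_le, h.eps_le]
  rw [layerSpeed]
  constructor <;> linarith [(abs_le.1 hdamping).1, (abs_le.1 hdamping).2]

theorem abs_layerSpeed_sub_le (h : IsAdmissible ψ b ε) (hv : |v| ≤ 1) (c x y : ℝ) :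
    |layerSpeed ψ b ε x v - layerSpeed ψ c ε y v| ≤ 5 * |x - y| + |b - c| := by
  have hforcing : |forcing x (ψ v) - forcing y (ψ v)| ≤ 5 * |x - y| :=
    (lipschitzWith_forcing_left (h.transition.abs_le_one v)).dist_le_mul x y
  have hdamping : |(b - c) * (ε * v)| ≤ |b - c| * (1 * 1) := by
    rw [abs_mul, abs_mul, abs_of_pos h.eps_pos]
    gcongr
    exact h.eps_le.trans (by norm_num)
  calc |layerSpeed ψ b ε x v - layerSpeed ψ c ε y v|
      = |(forcing x (ψ v) - forcing y (ψ v)) + (b - c) * (ε * v)| := by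
        rw [layerSpeed, layerSpeed]; ring_nf
    _ ≤ _ := (abs_add_le _ _).trans (by linarith)

end IsAdmissible

/-- An orbit crossing the layer inside the window, with the phase written as a function of
`v = y / ε`. The orbit enters at the phase `X 1` and leaves at the phase `X (-1)`. -/
structure IsLayerCurve (ψ : ℝ → ℝ) (b ε : ℝ) (X : ℝ → ℝ) : Prop
    extends IsAdmissible ψ b ε where
  mem : ∀ v ∈ Icc (-1 : ℝ) 1, X v ∈ crossingWindow
  continuousOn : ContinuousOn X (Icc (-1) 1)
  hasDerivAt : ∀ v ∈ Ioo (-1 : ℝ) 1, HasDerivAt X (-(ε / layerSpeed ψ b ε (X v) v)) v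

namespace HalfOrbit

theorem sub_le (h : HalfOrbit ψ b ε Y q r) (hxy : x ≤ y) (hx : x ∈ crossingWindow)
    (hy : y ∈ crossingWindow) : Y y - Y x ≤ -(1 / 4000) * (y - x) :=
  h.toIsAdmissible.sub_le h.isSol h.abs_le_three hxy hx hy

theorem mem_crossingWindow (h : HalfOrbit ψ b ε Y q r) (hx : x ∈ Icc q r) : x ∈ crossingWindow :=
  ⟨h.le_entry.trans hx.1, hx.2.trans h.exit_le⟩

theorem entry_mem (h : HalfOrbit ψ b ε Y q r) : q ∈ crossingWindow :=
  h.mem_crossingWindow (left_mem_Icc.2 h.entry_le_exit)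

theorem exit_mem (h : HalfOrbit ψ b ε Y q r) : r ∈ crossingWindow :=
  h.mem_crossingWindow (right_mem_Icc.2 h.entry_le_exit)

theorem exit_sub_entry_le (h : HalfOrbit ψ b ε Y q r) : r - q ≤ 8000 * ε := by
  have := h.sub_le h.entry_le_exit h.entry_mem h.exit_mem
  rw [h.at_entry, h.at_exit] at this
  linarith

theorem strictAntiOn (h : HalfOrbit ψ b ε Y q r) : StrictAntiOn Y crossingWindow :=
  fun x hx y hy hxy => by linarith [h.sub_le hxy.le hx hy]

theorem exists_layerCurve (h : HalfOrbit ψ b ε Y q r) :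
    ∃ X, IsLayerCurve ψ b ε X ∧ X 1 = q ∧ X (-1) = r ∧ ∀ v ∈ Icc (-1 : ℝ) 1, Y (X v) = ε * v := by
  have hε := h.eps_pos
  obtain ⟨X, hcont, hmem, hX⟩ := exists_continuousOn_rightInverse_of_mul_sub_le
    (f := fun x => Y x / ε) (c := 1 / 4000 / ε) (by positivity) h.entry_le_exit
    (h.isSol.continuous.div_const ε).continuousOn fun x hx y hy hxy => by
      rw [← sub_div, div_mul_eq_mul_div]
      gcongr
      linarith [h.sub_le hxy (h.mem_crossingWindow hx) (h.mem_crossingWindow hy)]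
  rw [h.at_entry, h.at_exit, neg_div, div_self hε.ne'] at hcont hmem hX
  have hYX (v : ℝ) (hv : v ∈ Icc (-1 : ℝ) 1) : Y (X v) = ε * v := by
    rw [← hX v hv, mul_div_cancel₀ _ hε.ne', hX v hv]
  have hwindow (v : ℝ) (hv : v ∈ Icc (-1 : ℝ) 1) : X v ∈ crossingWindow :=
    h.mem_crossingWindow (hmem hv)
  have h_one : (1 : ℝ) ∈ Icc (-1) 1 := by norm_num
  have h_neg_one : (-1 : ℝ) ∈ Icc (-1) 1 := by norm_num
  refine ⟨X, ⟨h.toIsAdmissible, hwindow, hcont, fun v hv => ?_⟩, ?_, ?_, hYX⟩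
  · have hv' := Ioo_subset_Icc_self hv
    have hspeed := (h.layerSpeed_mem (hwindow v hv') (abs_le.2 hv')).1
    have hderiv := (h.isSol (X v)).div_const ε
    rw [hYX v hv', scalarField_mul hε.ne', neg_div] at hderiv
    have hinv := hderiv.of_local_left_inverse
      ((hcont v hv').continuousAt (Icc_mem_nhds hv.1 hv.2))
      (neg_ne_zero.2 (div_ne_zero (by linarith) hε.ne'))
      (mem_of_superset (Icc_mem_nhds hv.1 hv.2) hX)
    rwa [inv_neg, inv_div] at hinv
  · exact h.strictAntiOn.injOn (hwindow 1 h_one) h.entry_mem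
      (by rw [hYX 1 h_one, h.at_entry, mul_one])
  · exact h.strictAntiOn.injOn (hwindow (-1) h_neg_one) h.exit_mem
      (by rw [hYX (-1) h_neg_one, h.at_exit, mul_neg_one])

end HalfOrbit

theorem abs_div_sub_div_le {d₁ d₂ : ℝ} (h₁ : 1 / 4000 ≤ d₁) (h₂ : 1 / 4000 ≤ d₂) (hε : 0 ≤ ε) :
    |ε / d₂ - ε / d₁| ≤ 16 * 10 ^ 6 * ε * |d₂ - d₁| := by
  have hd₁ : 0 < d₁ := by linarith
  have hd₂ : 0 < d₂ := by linarith
  have hprod : 1 / 4000 * (1 / 4000) ≤ d₂ * d₁ := mul_le_mul h₂ h₁ (by norm_num) hd₂.le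
  rw [div_sub_div _ _ hd₂.ne' hd₁.ne', mul_comm d₂ ε, ← mul_sub, abs_div, abs_mul, abs_of_nonneg hε,
    abs_of_pos (mul_pos hd₂ hd₁), abs_sub_comm, div_le_iff₀ (mul_pos hd₂ hd₁)]
  have := mul_le_mul_of_nonneg_left hprod (mul_nonneg hε (abs_nonneg (d₂ - d₁)))
  linarith

theorem abs_div_mul_sub_div_mul_le {A B d₁ d₂ e₁ e₂ : ℝ} (hd₁ : d₁ ∈ Icc (1 / 4000) 2)
    (hd₂ : 1 / 4000 ≤ d₂) (he₁ : 1 / 4000 ≤ e₁) (he₂ : e₂ ∈ Icc (1 / 4000) 2) (hB : |B| ≤ 5) :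
    |A / (d₁ * d₂) - B / (e₁ * e₂)| ≤
      16 * 10 ^ 6 * |A - B| + 10 ^ 16 * (|d₁ - e₁| + |d₂ - e₂|) := by
  have hd₁' : 0 < d₁ := by linarith [hd₁.1]
  have hd₂' : 0 < d₂ := by linarith
  have he₁' : 0 < e₁ := by linarith
  have he₂' : 0 < e₂ := by linarith [he₂.1]
  have hd_pos : 0 < 1 / (d₁ * d₂) := one_div_pos.2 (mul_pos hd₁' hd₂')
  have he_pos : 0 < 1 / (e₁ * e₂) := one_div_pos.2 (mul_pos he₁' he₂')
  have hd : 1 / (d₁ * d₂) ≤ 16 * 10 ^ 6 := by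
    rw [div_le_iff₀ (by positivity)]
    linarith [mul_le_mul hd₁.1 hd₂ (by norm_num) hd₁'.le]
  have he : 1 / (e₁ * e₂) ≤ 16 * 10 ^ 6 := by
    rw [div_le_iff₀ (by positivity)]
    linarith [mul_le_mul he₁ he₂.1 (by norm_num) he₁'.le]
  have hprod : |(e₁ - d₁) * e₂ + d₁ * (e₂ - d₂)| ≤ 2 * (|d₁ - e₁| + |d₂ - e₂|) :=
    calc _ ≤ |e₁ - d₁| * e₂ + d₁ * |e₂ - d₂| := by
          refine (abs_add_le _ _).trans_eq ?_
          rw [abs_mul, abs_mul, abs_of_pos he₂', abs_of_pos hd₁']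
      _ ≤ |e₁ - d₁| * 2 + 2 * |e₂ - d₂| := by gcongr; exacts [he₂.2, hd₁.2]
      _ = _ := by rw [abs_sub_comm e₁, abs_sub_comm e₂]; ring
  calc |A / (d₁ * d₂) - B / (e₁ * e₂)|
      = |(A - B) * (1 / (d₁ * d₂)) +
          B * ((e₁ - d₁) * e₂ + d₁ * (e₂ - d₂)) * (1 / (d₁ * d₂) * (1 / (e₁ * e₂)))| := by
        congr 1; field_simp; ring
    _ ≤ |A - B| * (1 / (d₁ * d₂)) + |B| * |(e₁ - d₁) * e₂ + d₁ * (e₂ - d₂)| *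
          (1 / (d₁ * d₂) * (1 / (e₁ * e₂))) := by
        refine (abs_add_le _ _).trans_eq ?_
        rw [abs_mul, abs_mul (B * _), abs_mul B, abs_of_pos hd_pos,
          abs_of_pos (mul_pos hd_pos he_pos)]
    _ ≤ |A - B| * (16 * 10 ^ 6) + 5 * (2 * (|d₁ - e₁| + |d₂ - e₂|)) *
          (16 * 10 ^ 6 * (16 * 10 ^ 6)) := by gcongr
    _ ≤ _ := by linarith [abs_nonneg (d₁ - e₁), abs_nonneg (d₂ - e₂)]

theorem IsAdmissible.abs_forcingDeriv_div_sub_le {D z w x₁ x₂ y₁ y₂ : ℝ} (hb : IsAdmissible ψ b ε)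
    (hc : IsAdmissible ψ c ε) (hv : |v| ≤ 1) (hx₁ : x₁ ∈ crossingWindow)
    (hx₂ : x₂ ∈ crossingWindow) (hy₁ : y₁ ∈ crossingWindow) (hy₂ : y₂ ∈ crossingWindow)
    (h₁ : |x₁ - y₁| ≤ D) (h₂ : |x₂ - y₂| ≤ D) (hzw : |z - w| ≤ 2 * D) :
    |forcingDeriv z (ψ v) / (layerSpeed ψ b ε x₁ v * layerSpeed ψ b ε x₂ v) -
      forcingDeriv w (ψ v) / (layerSpeed ψ c ε y₁ v * layerSpeed ψ c ε y₂ v)| ≤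
      5 * 10 ^ 17 * (D + |b - c|) := by
  have hquot := abs_div_mul_sub_div_mul_le (A := forcingDeriv z (ψ v))
    (hb.layerSpeed_mem hx₁ hv) (hb.layerSpeed_mem hx₂ hv).1 (hc.layerSpeed_mem hy₁ hv).1
    (hc.layerSpeed_mem hy₂ hv) (abs_forcingDeriv_le w (hb.transition.abs_le_one v))
  linarith [abs_forcingDeriv_sub_le z w (hb.transition.abs_le_one v),
    hb.abs_layerSpeed_sub_le hv c x₁ y₁, hb.abs_layerSpeed_sub_le hv c x₂ y₂,
    abs_nonneg (b - c), abs_nonneg (x₁ - y₁)]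

namespace IsLayerCurve

theorem abs_sub_sub_le (h₁ : IsLayerCurve ψ b ε X₁) (h₂ : IsLayerCurve ψ c ε X₂)
    (hv : v ∈ Icc (-1) 1) :
    |(X₂ v - X₁ v) - (X₂ 1 - X₁ 1)| ≤ 10 ^ 9 * ε * (|X₂ 1 - X₁ 1| + |c - b|) := by
  have hε := h₁.eps_pos
  have hε_le := h₁.eps_le
  have hbound := abs_image_sub_le_of_abs_hasDerivAt_le_mul_add (k := 80 * 10 ^ 6 * ε)
    (β := |c - b|) (by positivity) (by linarith) (abs_nonneg _)
    (h₂.continuousOn.sub h₁.continuousOn)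
    (fun w hw => (h₂.hasDerivAt w hw).sub (h₁.hasDerivAt w hw)) (fun w hw => ?_) hv
  · refine hbound.trans ?_
    rw [Pi.sub_apply]
    refine mul_le_mul_of_nonneg_right ?_ (by positivity)
    linarith
  have hw' := Ioo_subset_Icc_self hw
  have hspeed := h₂.abs_layerSpeed_sub_le (abs_le.2 hw') b (X₂ w) (X₁ w)
  rw [neg_sub_neg, abs_sub_comm, Pi.sub_apply]
  calc _ ≤ 16 * 10 ^ 6 * ε * |layerSpeed ψ c ε (X₂ w) w - layerSpeed ψ b ε (X₁ w) w| :=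
        abs_div_sub_div_le (h₁.layerSpeed_mem (h₁.mem w hw') (abs_le.2 hw')).1
          (h₂.layerSpeed_mem (h₂.mem w hw') (abs_le.2 hw')).1 hε.le
    _ ≤ 16 * 10 ^ 6 * ε * (5 * (|X₂ w - X₁ w| + |c - b|)) := by
        gcongr
        linarith [abs_nonneg (c - b)]
    _ = 80 * 10 ^ 6 * ε * (|X₂ w - X₁ w| + |c - b|) := by ring

theorem exists_hasDerivAt_log_sub (h₁ : IsLayerCurve ψ b ε X₁) (h₂ : IsLayerCurve ψ b ε X₂)
    (hv : v ∈ Ioo (-1) 1) (hlt : X₁ v < X₂ v) :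
    ∃ z ∈ Ioo (X₁ v) (X₂ v), HasDerivAt (fun v => log (X₂ v - X₁ v))
      (ε * (forcingDeriv z (ψ v) / (layerSpeed ψ b ε (X₁ v) v * layerSpeed ψ b ε (X₂ v) v))) v := by
  have hv' := Ioo_subset_Icc_self hv
  have hspeed₁ := (h₁.layerSpeed_mem (h₁.mem v hv') (abs_le.2 hv')).1
  have hspeed₂ := (h₂.layerSpeed_mem (h₂.mem v hv') (abs_le.2 hv')).1
  obtain ⟨z, hz, hslope⟩ := exists_forcing_slope (ψ v) hlt
  have hslope' : forcingDeriv z (ψ v) * (X₂ v - X₁ v) =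
      layerSpeed ψ b ε (X₂ v) v - layerSpeed ψ b ε (X₁ v) v := by
    rw [← hslope, layerSpeed, layerSpeed, add_sub_add_right_eq_sub]
  have hne := (sub_pos.2 hlt).ne'
  refine ⟨z, hz, (((h₂.hasDerivAt v hv).sub (h₁.hasDerivAt v hv)).log hne).congr_deriv ?_⟩
  rw [Pi.sub_apply, div_eq_iff hne, mul_assoc, div_mul_eq_mul_div, hslope']
  have hne₁ : layerSpeed ψ b ε (X₁ v) v ≠ 0 := by linarith
  have hne₂ : layerSpeed ψ b ε (X₂ v) v ≠ 0 := by linarith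
  field_simp
  ring

theorem abs_log_sub_le (h₁ : IsLayerCurve ψ b ε X₁) (h₂ : IsLayerCurve ψ b ε X₂)
    (k₁ : IsLayerCurve ψ c ε V₁) (k₂ : IsLayerCurve ψ c ε V₂)
    (hX : ∀ v ∈ Icc (-1) 1, X₁ v < X₂ v) (hV : ∀ v ∈ Icc (-1) 1, V₁ v < V₂ v) {D : ℝ}
    (hD₁ : ∀ v ∈ Icc (-1) 1, |X₁ v - V₁ v| ≤ D) (hD₂ : ∀ v ∈ Icc (-1) 1, |X₂ v - V₂ v| ≤ D)
    (hD : ∀ v ∈ Icc (-1) 1, X₂ v - X₁ v ≤ D) :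
    |(log (X₂ 1 - X₁ 1) - log (V₂ 1 - V₁ 1)) -
      (log (X₂ (-1) - X₁ (-1)) - log (V₂ (-1) - V₁ (-1)))| ≤ 10 ^ 18 * ε * (D + |b - c|) := by
  have hderiv (v : ℝ) (hv : v ∈ Ioo (-1) 1) : ∃ κ, |κ| ≤ 5 * 10 ^ 17 * ε * (D + |b - c|) ∧
      HasDerivAt (fun v => log (X₂ v - X₁ v) - log (V₂ v - V₁ v)) κ v := by
    have hv' := Ioo_subset_Icc_self hv
    obtain ⟨z, hz, hrate⟩ := h₁.exists_hasDerivAt_log_sub h₂ hv (hX v hv')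
    obtain ⟨w, hw, hrate'⟩ := k₁.exists_hasDerivAt_log_sub k₂ hv (hV v hv')
    have hclose₁ := abs_le.1 (hD₁ v hv')
    have hclose₂ := abs_le.1 (hD₂ v hv')
    have hzw : |z - w| ≤ 2 * D :=
      abs_le.2 (by constructor <;> linarith [hz.1, hz.2, hw.1, hw.2, hD v hv'])
    refine ⟨_, ?_, hrate.sub hrate'⟩
    rw [← mul_sub, abs_mul, abs_of_pos h₁.eps_pos, mul_comm (5 * 10 ^ 17) ε, mul_assoc]
    gcongr
    · exact h₁.eps_pos.le
    · exact h₁.toIsAdmissible.abs_forcingDeriv_div_sub_le k₁.toIsAdmissible (abs_le.2 hv')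
        (h₁.mem v hv') (h₂.mem v hv') (k₁.mem v hv') (k₂.mem v hv') (hD₁ v hv') (hD₂ v hv') hzw
  choose! κ hκ hκ_deriv using hderiv
  have hmvt := abs_image_sub_le_of_abs_hasDerivAt_Ioo_le (by norm_num : (-1 : ℝ) ≤ 1)
    (((h₂.continuousOn.sub h₁.continuousOn).log fun v hv => (sub_pos.2 (hX v hv)).ne').sub
      ((k₂.continuousOn.sub k₁.continuousOn).log fun v hv => (sub_pos.2 (hV v hv)).ne'))
    hκ_deriv hκ
  refine hmvt.trans_eq ?_
  ring

end IsLayerCurve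

end Layer

section Reversal

variable {ψ : ℝ → ℝ} {a b ε q r q' r' x y : ℝ} {Y Z : ℝ → ℝ}

namespace HalfOrbit

theorem abs_motion_above_le (h : HalfOrbit ψ b ε Y q r) (hx : x ∈ Icc 0 q) :
    |Y x - Y 0 - 2 / (3 * π) * (cos (3 * π * x / 2) - 1)| ≤ 1 / 10 ^ 20 := by
  have hmotion := h.isSol.abs_sub_above_le h.transition h.eps_pos hx.1
    (fun z hz => h.above z ⟨hz.1, hz.2.trans hx.2⟩)
    (fun z hz => h.abs_le_three z ⟨hz.1, by linarith [hz.2, hx.2, h.entry_mem.2]⟩)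
  rw [mul_zero, zero_div, cos_zero] at hmotion
  refine hmotion.trans ?_
  calc |b| * 3 * (x - 0) ≤ 1 / 10 ^ 30 * 3 * 1 := by
        gcongr
        · exact sub_nonneg.2 hx.1
        · exact h.abs_damping_le
        · linarith [hx.2, h.entry_mem.2]
    _ ≤ 1 / 10 ^ 20 := by norm_num

theorem le_entry_of_high (h : HalfOrbit ψ b ε Y q r) (h₀ : Y 0 = initialHigh) :
    2 / 3 - 1 / 1500 ≤ q := by
  by_contra! hlt
  have hq : 0 ≤ q := by linarith [h.le_entry]
  have hmotion := (abs_le.1 (h.abs_motion_above_le (right_mem_Icc.2 hq))).1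
  rw [h.at_entry, h₀, initialHigh] at hmotion
  have hanti : cos (3 * π * (2 / 3 - 1 / 1500) / 2) ≤ cos (3 * π * q / 2) :=
    cos_le_cos_of_nonneg_of_le_pi (by positivity) (by linarith [pi_pos]) (by gcongr)
  have hdrop := le_cos_three_half_sub (x := 2 / 3 - 1 / 1500) (y := 2 / 3 - 1 / 2000) (by norm_num)
    (by norm_num) (by norm_num)
  have hfall := mul_le_mul two_div_three_pi_mem.1 (hdrop.trans (sub_le_sub_right hanti _))
    (by norm_num) (two_div_three_pi_mem.1.trans' (by norm_num))
  linarith [h.eps_le]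

theorem le_of_high (h : HalfOrbit ψ b ε Y q r) (h₀ : Y 0 = initialHigh) (hx : x ∈ Icc 0 (1 / 3)) :
    3 / 20 ≤ Y x := by
  have hentry := h.le_entry_of_high h₀
  have hmotion := (abs_le.1 (h.abs_motion_above_le ⟨hx.1, by linarith [hx.2]⟩)).1
  have hcos : 0 ≤ cos (3 * π * x / 2) :=
    cos_nonneg_of_neg_pi_div_two_le_of_le
      (by linarith [mul_nonneg pi_pos.le hx.1, pi_pos])
      (by linarith [mul_le_mul_of_nonneg_left hx.2 pi_pos.le])
  have hcos_high : cos (3 * π * (2 / 3 - 1 / 2000) / 2) ≤ -(99 / 100) := by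
    rw [show 3 * π * (2 / 3 - 1 / 2000) / 2 = π - 3 * π / 4000 by ring, cos_pi_sub]
    nlinarith [one_sub_sq_div_two_le_cos (x := 3 * π / 4000), pi_pos, pi_le_four]
  have hheight := mul_le_mul two_div_three_pi_mem.1
    (show 99 / 100 ≤ cos (3 * π * x / 2) - cos (3 * π * (2 / 3 - 1 / 2000) / 2) by linarith)
    (by norm_num) (two_div_three_pi_mem.1.trans' (by norm_num))
  rw [h₀, initialHigh] at hmotion
  linarith

theorem le_of_low (h : HalfOrbit ψ b ε Y q r) (h₀ : Y 0 = initialLow) (hx : x ∈ Icc 0 q) :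
    Y x ≤ 3 / 10 := by
  have hmotion := (abs_le.1 (h.abs_motion_above_le hx)).2
  have hcos := mul_le_mul_of_nonneg_left (cos_le_one (3 * π * x / 2))
    (two_div_three_pi_mem.1.trans' (by norm_num))
  rw [h₀, initialLow] at hmotion
  linarith [two_div_three_pi_mem.2]

theorem entry_le_of_low (h : HalfOrbit ψ b ε Y q r) (h₀ : Y 0 = initialLow) : q ≤ 35 / 100 := by
  by_contra! hlt
  have hq : 0 ≤ q := by linarith
  have hmotion := (abs_le.1 (h.abs_motion_above_le (right_mem_Icc.2 hq))).2
  rw [h.at_entry, h₀, initialLow] at hmotion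
  have hanti : cos (3 * π * q / 2) ≤ cos (3 * π * (35 / 100) / 2) :=
    cos_le_cos_of_nonneg_of_le_pi (by positivity)
      (by linarith [mul_le_mul_of_nonneg_left h.entry_mem.2 pi_pos.le, pi_pos]) (by gcongr)
  have hsin := two_mul_le_sin_pi_mul (t := 25 / 1000) (by norm_num) (by norm_num)
  have hcos : cos (3 * π * (35 / 100) / 2) = -sin (π * (25 / 1000)) := by
    rw [show 3 * π * (35 / 100) / 2 = π * (25 / 1000) + π / 2 by ring, cos_add_pi_div_two]
  have hfall := mul_le_mul two_div_three_pi_mem.1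
    (show 1 / 20 ≤ -cos (3 * π * q / 2) by linarith) (by norm_num)
    (two_div_three_pi_mem.1.trans' (by norm_num))
  linarith [h.eps_pos]

theorem le_of_exit_le (h : HalfOrbit ψ b ε Y q r) (hr : r ≤ 4 / 10) (hx : x ∈ Icc 1 2) :
    Y x ≤ -(3 / 10) := by
  have hr₀ : 3 / 10 ≤ r := h.exit_mem.1
  have hmotion := (abs_le.1 (h.isSol.abs_sub_below_le h.transition h.eps_pos
    (hr.trans (by linarith [hx.1])) (fun z hz => h.below z ⟨hz.1, hz.2.trans hx.2⟩)
    (fun z hz => h.abs_le_three z ⟨by linarith [hz.1], hz.2.trans hx.2⟩))).2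
  rw [h.at_exit] at hmotion
  have hcos : cos (π * x / 2) ≤ 0 :=
    cos_nonpos_of_pi_div_two_le_of_le (by linarith [mul_le_mul_of_nonneg_left hx.1 pi_pos.le])
      (by linarith [mul_le_mul_of_nonneg_left hx.2 pi_pos.le, pi_pos])
  have hcos_exit := le_sin_half (x := 1 - r) (by linarith) (by linarith)
  rw [show π * (1 - r) / 2 = π / 2 - π * r / 2 by ring, sin_pi_div_two_sub] at hcos_exit
  have hfall := mul_le_mul le_two_div_pi
    (show 6 / 10 ≤ cos (π * r / 2) - cos (π * x / 2) by linarith) (by norm_num) (by positivity)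
  have hdamping : |b| * 3 * (x - r) ≤ 1 / 10 ^ 30 * 3 * 2 := by
    gcongr
    · linarith [hx.1]
    · exact h.abs_damping_le
    · linarith [hx.2]
  linarith [h.eps_pos]

end HalfOrbit

/-- A half orbit `Y` of the damped equation and the half orbit `Z` of the equation with reversed
damping which starts at the same point. Reflected in `x = 0`, the latter continues the former
backwards. -/
structure ReversalPair (ψ : ℝ → ℝ) (a ε : ℝ) (Y Z : ℝ → ℝ) (q r q' r' : ℝ) : Prop where
  pos : 0 < a
  damped : HalfOrbit ψ a ε Y q r
  reversed : HalfOrbit ψ (-a) ε Z q' r'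
  initial : Y 0 = Z 0

namespace ReversalPair

theorem damping_le (h : ReversalPair ψ a ε Y Z q r q' r') : a ≤ 1 / 10 ^ 30 :=
  (le_abs_self a).trans h.damped.abs_damping_le

theorem hasDerivAt_sub_above (h : ReversalPair ψ a ε Y Z q r q' r') (hx : x ∈ Icc 0 q)
    (hx' : x ∈ Icc 0 q') : HasDerivAt (fun x => Z x - Y x) (a * (Z x + Y x)) x := by
  refine ((h.reversed.isSol x).sub (h.damped.isSol x)).congr_deriv ?_
  rw [scalarField_of_le h.damped.transition h.damped.eps_pos (h.damped.above x hx),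
    scalarField_of_le h.damped.transition h.damped.eps_pos (h.reversed.above x hx')]
  ring

theorem hasDerivAt_sub_below (h : ReversalPair ψ a ε Y Z q r q' r') (hx : x ∈ Icc r 2)
    (hx' : x ∈ Icc r' 2) : HasDerivAt (fun x => Z x - Y x) (a * (Z x + Y x)) x := by
  refine ((h.reversed.isSol x).sub (h.damped.isSol x)).congr_deriv ?_
  rw [scalarField_of_le_neg h.damped.transition h.damped.eps_pos (h.damped.below x hx),
    scalarField_of_le_neg h.damped.transition h.damped.eps_pos (h.reversed.below x hx')]
  ring

theorem sub_le_sub_above (h : ReversalPair ψ a ε Y Z q r q' r') (hx : 0 ≤ x) (hxy : x ≤ y)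
    (hy : y ≤ q) (hy' : y ≤ q') : Z x - Y x ≤ Z y - Y y := by
  have hmono := le_image_sub_of_le_hasDerivAt (C := 0) hxy
    (fun z hz => h.hasDerivAt_sub_above ⟨hx.trans hz.1, hz.2.trans hy⟩
      ⟨hx.trans hz.1, hz.2.trans hy'⟩)
    (fun z hz => mul_nonneg h.pos.le (by
      linarith [h.damped.above z ⟨hx.trans hz.1, hz.2.trans hy⟩,
        h.reversed.above z ⟨hx.trans hz.1, hz.2.trans hy'⟩, h.damped.eps_pos]))
  linarith

theorem sub_le_sub_below (h : ReversalPair ψ a ε Y Z q r q' r') (hx : r ≤ x) (hx' : r' ≤ x)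
    (hxy : x ≤ y) (hy : y ≤ 2) : Z y - Y y ≤ Z x - Y x := by
  have hanti := image_sub_le_of_hasDerivAt_le (C := 0) hxy
    (fun z hz => h.hasDerivAt_sub_below ⟨hx.trans hz.1, hz.2.trans hy⟩
      ⟨hx'.trans hz.1, hz.2.trans hy⟩)
    (fun z hz => mul_nonpos_of_nonneg_of_nonpos h.pos.le (by
      linarith [h.damped.below z ⟨hx.trans hz.1, hz.2.trans hy⟩,
        h.reversed.below z ⟨hx'.trans hz.1, hz.2.trans hy⟩, h.damped.eps_pos]))
  linarith

theorem entry_le_entry (h : ReversalPair ψ a ε Y Z q r q' r') : q ≤ q' := by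
  by_contra! hlt
  have hq' := h.reversed.entry_mem
  have hmono := h.sub_le_sub_above le_rfl (by linarith [hq'.1]) hlt.le le_rfl
  have hfall := h.damped.strictAntiOn hq' h.damped.entry_mem hlt
  rw [h.damped.at_entry] at hfall
  rw [h.initial, h.reversed.at_entry] at hmono
  linarith

theorem le_above (h : ReversalPair ψ a ε Y Z q r q' r') (hx : x ∈ Icc 0 q) : Y x ≤ Z x := by
  have hmono := h.sub_le_sub_above le_rfl hx.1 hx.2 (hx.2.trans h.entry_le_entry)
  rw [h.initial] at hmono
  linarith

theorem entry_gap_le (h : ReversalPair ψ a ε Y Z q r q' r') {M : ℝ}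
    (hM : ∀ x ∈ Icc 0 q, Z x + Y x ≤ M) : Z q - ε ≤ a * M * q := by
  have hgrowth := image_sub_le_of_hasDerivAt_le (h.damped.entry_mem.1.trans' (by norm_num))
    (fun x hx => h.hasDerivAt_sub_above hx ⟨hx.1, hx.2.trans h.entry_le_entry⟩)
    (fun x hx => mul_le_mul_of_nonneg_left (hM x hx) h.pos.le)
  rw [h.initial, h.damped.at_entry] at hgrowth
  linarith

theorem entry_sub_entry_le (h : ReversalPair ψ a ε Y Z q r q' r') : q' - q ≤ 20000 * a := by
  have hq := h.damped.entry_mem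
  have hgap := h.entry_gap_le (M := 6) fun x hx => by
    have hx₂ : x ∈ Icc (0 : ℝ) 2 := ⟨hx.1, by linarith [hx.2, hq.2]⟩
    linarith [(abs_le.1 (h.damped.abs_le_three x hx₂)).2,
      (abs_le.1 (h.reversed.abs_le_three x hx₂)).2]
  have hfall := h.reversed.sub_le h.entry_le_entry hq h.reversed.entry_mem
  rw [h.reversed.at_entry] at hfall
  linarith [mul_le_mul_of_nonneg_left hq.2 h.pos.le, h.pos]

theorem abs_layer_sub_sub_le (h : ReversalPair ψ a ε Y Z q r q' r') {X V : ℝ → ℝ} {v : ℝ}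
    (hX : IsLayerCurve ψ a ε X) (hV : IsLayerCurve ψ (-a) ε V) (hXq : X 1 = q) (hVq : V 1 = q')
    (hv : v ∈ Icc (-1) 1) : |(V v - X v) - (q' - q)| ≤ a / 10 ^ 8 := by
  have hlayer := hX.abs_sub_sub_le hV hv
  rw [hXq, hVq, abs_of_nonneg (sub_nonneg.2 h.entry_le_entry), show -a - a = -(2 * a) by ring,
    abs_neg, abs_of_pos (mul_pos two_pos h.pos)] at hlayer
  calc _ ≤ 10 ^ 9 * ε * (q' - q + 2 * a) := hlayer
    _ ≤ 10 ^ 9 * (1 / 10 ^ 30) * (30000 * a) := by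
        gcongr
        · linarith [h.entry_le_entry, h.pos]
        · exact h.damped.eps_le
        · linarith [h.entry_sub_entry_le, h.pos]
    _ ≤ a / 10 ^ 8 := by linarith [h.pos]

theorem abs_exit_sub_sub_le (h : ReversalPair ψ a ε Y Z q r q' r') :
    |(r' - r) - (q' - q)| ≤ a / 10 ^ 8 := by
  obtain ⟨X, hX, hXq, rfl, -⟩ := h.damped.exists_layerCurve
  obtain ⟨V, hV, hVq, rfl, -⟩ := h.reversed.exists_layerCurve
  exact h.abs_layer_sub_sub_le hX hV hXq hVq (by norm_num)

theorem le_entry_gap_of_high (h : ReversalPair ψ a ε Y Z q r q' r') (h₀ : Y 0 = initialHigh) :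
    1 / 10 * a ≤ Z q - ε := by
  have hq := h.damped.le_entry_of_high h₀
  have habove (x : ℝ) (hx : x ∈ Icc 0 (1 / 3)) : x ∈ Icc 0 q := ⟨hx.1, by linarith [hx.2]⟩
  have hgrowth := le_image_sub_of_le_hasDerivAt (p := 0) (s := 1 / 3) (C := a * (3 / 10))
    (by norm_num)
    (fun x hx => h.hasDerivAt_sub_above (habove x hx)
      ⟨hx.1, (habove x hx).2.trans h.entry_le_entry⟩)
    (fun x hx => mul_le_mul_of_nonneg_left
      (by linarith [h.damped.le_of_high h₀ hx, h.le_above (habove x hx)]) h.pos.le)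
  have hmono := h.sub_le_sub_above (x := 1 / 3) (by norm_num) (by linarith) le_rfl h.entry_le_entry
  rw [h.initial] at hgrowth
  rw [h.damped.at_entry] at hmono
  linarith

theorem le_entry_sub_entry_of_high (h : ReversalPair ψ a ε Y Z q r q' r')
    (h₀ : Y 0 = initialHigh) : 30 * a ≤ q' - q := by
  have hq := h.damped.le_entry_of_high h₀
  have hq' := h.reversed.entry_mem.2
  have hslow := le_image_sub_of_le_hasDerivAt (C := -(1 / 300)) h.entry_le_entry
    (fun x _ => h.reversed.isSol x) fun x hx => by
      have hZ := h.reversed.above x ⟨by linarith [hx.1], hx.2⟩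
      rw [scalarField_of_le h.reversed.transition h.reversed.eps_pos hZ, neg_mul, neg_neg]
      have hphase : 0 ≤ 2 / 3 - x := by linarith [hx.2]
      have hsin : sin (3 * π * x / 2) ≤ 3 * π / 2 * (2 / 3 - x) := by
        rw [← sin_pi_sub]
        exact (sin_le (by linarith [mul_nonneg pi_pos.le hphase])).trans_eq (by ring)
      have hsmall : 3 * π / 2 * (2 / 3 - x) ≤ 5 * (1 / 1500) :=
        mul_le_mul (by linarith [pi_lt_d2]) (by linarith [hx.1]) hphase (by norm_num)
      linarith [mul_nonneg h.pos.le (h.damped.eps_pos.le.trans hZ)]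
  rw [h.reversed.at_entry] at hslow
  linarith [h.le_entry_gap_of_high h₀]

theorem le_exit_sub_exit_of_high (h : ReversalPair ψ a ε Y Z q r q' r') (h₀ : Y 0 = initialHigh) :
    29 * a ≤ r' - r := by
  linarith [h.le_entry_sub_entry_of_high h₀, (abs_le.1 h.abs_exit_sub_sub_le).1, h.pos]

theorem end_lt_end_of_high (h : ReversalPair ψ a ε Y Z q r q' r') (h₀ : Y 0 = initialHigh) :
    Y 2 < Z 2 := by
  have hr : 2 / 3 - 1 / 1500 ≤ r := (h.damped.le_entry_of_high h₀).trans h.damped.entry_le_exit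
  have hr' := h.reversed.exit_mem.2
  have hexit := h.le_exit_sub_exit_of_high h₀
  have hrr' : r ≤ r' := by linarith [h.pos]
  have hfall := image_sub_le_of_hasDerivAt_le (C := -(1 / 2)) hrr' (fun x _ => h.damped.isSol x)
    fun x hx => by
      have hx₂ : x ≤ 2 := by linarith [hx.2]
      rw [scalarField_of_le_neg h.damped.transition h.damped.eps_pos
        (h.damped.below x ⟨hx.1, hx₂⟩)]
      linarith [le_sin_half (x := x) (by linarith [hx.1]) (by linarith [hx.2]), hx.1,
        neg_abs_le (a * Y x),
        h.damped.abs_damping_mul_le (h.damped.abs_le_three x ⟨by linarith [hx.1], hx₂⟩)]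
  have hgain := le_image_sub_of_le_hasDerivAt (p := r') (s := 2) (C := a * -6) (by linarith)
    (fun x hx => h.hasDerivAt_sub_below ⟨hrr'.trans hx.1, hx.2⟩ hx)
    (fun x hx => by
      have hx₂ : x ∈ Icc 0 2 := ⟨by linarith [hx.1], hx.2⟩
      exact mul_le_mul_of_nonneg_left (by
        linarith [(abs_le.1 (h.damped.abs_le_three x hx₂)).1,
          (abs_le.1 (h.reversed.abs_le_three x hx₂)).1]) h.pos.le)
  rw [h.damped.at_exit] at hfall
  rw [h.reversed.at_exit] at hgain
  linarith [mul_nonneg h.pos.le (show 0 ≤ r' by linarith), h.pos]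

theorem entry_sub_entry_le_of_low (h : ReversalPair ψ a ε Y Z q r q' r') (h₀ : Y 0 = initialLow) :
    q' - q ≤ 1 / 4 * a := by
  have hq := h.damped.entry_mem.1
  have hq' := h.reversed.entry_le_of_low (h.initial ▸ h₀)
  have hgap := h.entry_gap_le (M := 6 / 10) fun x hx => by
    linarith [h.damped.le_of_low h₀ hx,
      h.reversed.le_of_low (h.initial ▸ h₀) ⟨hx.1, hx.2.trans h.entry_le_entry⟩]
  have hfall := image_sub_le_of_hasDerivAt_le (C := -(89 / 100)) h.entry_le_entry
    (fun x _ => h.reversed.isSol x) fun x hx => by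
      have hx₀ : 0 ≤ x := by linarith [hx.1]
      rw [scalarField_of_le h.reversed.transition h.reversed.eps_pos
        (h.reversed.above x ⟨hx₀, hx.2⟩)]
      have hsin : 9 / 10 ≤ sin (3 * π * x / 2) := by
        rw [show 3 * π * x / 2 = π * (3 * x / 2) by ring]
        rcases le_total (3 * x / 2) (1 / 2) with hle | hge
        · linarith [two_mul_le_sin_pi_mul (t := 3 * x / 2) (by linarith) hle, hx.1]
        · linarith [two_mul_one_sub_le_sin_pi_mul (t := 3 * x / 2) hge (by linarith [hx.2]), hx.2]
      linarith [neg_abs_le (-a * Z x), h.reversed.abs_damping_mul_le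
        (h.reversed.abs_le_three x ⟨hx₀, by linarith [hx.2]⟩)]
  rw [h.reversed.at_entry] at hfall
  linarith [mul_le_mul_of_nonneg_left (h.entry_le_entry.trans hq') h.pos.le, h.pos]

theorem exit_sub_exit_le_of_low (h : ReversalPair ψ a ε Y Z q r q' r') (h₀ : Y 0 = initialLow) :
    r' - r ≤ 3 / 10 * a := by
  linarith [h.entry_sub_entry_le_of_low h₀, (abs_le.1 h.abs_exit_sub_sub_le).2, h.pos]

theorem sub_max_exit_le (h : ReversalPair ψ a ε Y Z q r q' r') :
    Z (max r r') - Y (max r r') ≤ max 0 (r' - r) := by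
  rcases le_total r r' with hle | hge
  · have hr' := h.reversed.exit_mem.2
    have hfall := le_image_sub_of_le_hasDerivAt (C := -1) hle (fun x _ => h.damped.isSol x)
      fun x hx => by
        have hY := h.damped.below x ⟨hx.1, by linarith [hx.2]⟩
        rw [scalarField_of_le_neg h.damped.transition h.damped.eps_pos hY]
        linarith [sin_le_one (π * x / 2),
          mul_nonneg h.pos.le (show 0 ≤ -Y x by linarith [h.damped.eps_pos])]
    rw [h.damped.at_exit] at hfall
    rw [max_eq_right hle, h.reversed.at_exit]
    exact le_max_of_le_right (by linarith)
  · rw [max_eq_left hge, h.damped.at_exit]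
    exact le_max_of_le_left
      (by linarith [h.reversed.below r ⟨hge, by linarith [h.damped.exit_mem.2]⟩])

theorem end_lt_end_of_low (h : ReversalPair ψ a ε Y Z q r q' r') (h₀ : Y 0 = initialLow) :
    Z 2 < Y 2 := by
  have hq := h.damped.entry_le_of_low h₀
  have hq' := h.reversed.entry_le_of_low (h.initial ▸ h₀)
  have hr : r ≤ 4 / 10 := by linarith [h.damped.exit_sub_entry_le, h.damped.eps_le]
  have hr' : r' ≤ 4 / 10 := by linarith [h.reversed.exit_sub_entry_le, h.damped.eps_le]
  have hexit : max 0 (r' - r) ≤ 3 / 10 * a :=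
    max_le (by linarith [h.pos]) (h.exit_sub_exit_le_of_low h₀)
  have hanti := h.sub_le_sub_below (y := 1) (le_max_left r r') (le_max_right r r')
    (max_le (by linarith) (by linarith)) (by norm_num)
  have hdrop := image_sub_le_of_hasDerivAt_le (p := 1) (s := 2) (C := a * -(6 / 10)) (by norm_num)
    (fun x hx => h.hasDerivAt_sub_below ⟨by linarith [hx.1], hx.2⟩ ⟨by linarith [hx.1], hx.2⟩)
    (fun x hx => mul_le_mul_of_nonneg_left
      (by linarith [h.damped.le_of_exit_le hr hx, h.reversed.le_of_exit_le hr' hx]) h.pos.le)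
  linarith [h.sub_max_exit_le, h.pos]

end ReversalPair

end Reversal

section TrigonometricFactors

theorem mul_sin_half_le_sin_three_half {p s x : ℝ} (hp : 0 ≤ p) (hs : s ∈ crossingWindow)
    (hx : x ∈ Icc p s) :
    (1 + 2 * cos (π * s)) * sin (π * p / 2) ≤ sin (3 * π * x / 2) := by
  have hs₁ : s ≤ 1 := by linarith [hs.2]
  rw [sin_three_mul_half]
  have hsin := sin_half_le_sin_half hp hx.1 (hx.2.trans hs₁)
  have hcos := cos_pi_mul_le_cos_pi_mul (hp.trans hx.1) hx.2 hs₁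
  exact mul_le_mul (by linarith) hsin
    (hp.trans (le_sin_half hp (hx.1.trans (hx.2.trans hs₁)))) (by linarith [le_one_add_two_cos hs])

theorem sin_three_half_le_mul_sin_half {p s x : ℝ} (hp : p ∈ crossingWindow) (hs : s ≤ 1)
    (hx : x ∈ Icc p s) :
    sin (3 * π * x / 2) ≤ (1 + 2 * cos (π * p)) * sin (π * s / 2) := by
  have hp₀ : 0 ≤ p := by linarith [hp.1]
  rw [sin_three_mul_half]
  have hsin := sin_half_le_sin_half (hp₀.trans hx.1) hx.2 hs
  have hcos := cos_pi_mul_le_cos_pi_mul hp₀ hx.1 (hx.2.trans hs)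
  exact mul_le_mul (by linarith) hsin
    ((hp₀.trans hx.1).trans (le_sin_half (hp₀.trans hx.1) (hx.2.trans hs)))
    (by linarith [le_one_add_two_cos hp])

theorem log_one_add_two_cos_le {x y z : ℝ} (hxy : x ≤ y) (hxz : x ≤ z) (hx : x ∈ crossingWindow)
    (hy : y ∈ crossingWindow) (hz : z ∈ crossingWindow) :
    log (1 + 2 * cos (π * z)) ≤ log (1 + 2 * cos (π * y)) + 16000 * (y - x) := by
  have hposz := le_one_add_two_cos hz
  have hposy := le_one_add_two_cos hy
  have hanti := cos_pi_mul_le_cos_pi_mul (by linarith [hx.1]) hxz (by linarith [hz.2])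
  have hlip : cos (π * x) - cos (π * y) ≤ 4 * (y - x) := by
    have habs := (le_abs_self _).trans (abs_cos_sub_cos_le (π * x) (π * y))
    rw [← mul_sub, abs_mul, abs_of_pos pi_pos, abs_sub_comm, abs_of_nonneg (sub_nonneg.2 hxy)]
      at habs
    exact habs.trans (mul_le_mul_of_nonneg_right pi_le_four (sub_nonneg.2 hxy))
  refine log_le_log_add (by linarith) (by linarith) (by linarith) ?_
  linarith [mul_le_mul_of_nonneg_right hposy (sub_nonneg.2 hxy)]

theorem sin_half_mul_sin_half_sub_le (x₁ x₂ y₁ y₂ : ℝ) :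
    sin (π * x₁ / 2) * sin (π * x₂ / 2) - sin (π * y₁ / 2) * sin (π * y₂ / 2) ≤
      |x₁ + x₂ - (y₁ + y₂)| + |(x₁ - x₂) + (y₁ - y₂)| * |(x₁ - x₂) - (y₁ - y₂)| := by
  have hprod (x y : ℝ) : sin (π * x / 2) * sin (π * y / 2) =
      (cos (π / 2 * (x - y)) - cos (π / 2 * (x + y))) / 2 := by
    rw [mul_sub, mul_add, cos_sub, cos_add, mul_div_right_comm, mul_div_right_comm]
    ring
  have hsum := abs_cos_sub_cos_le (π / 2 * (x₁ + x₂)) (π / 2 * (y₁ + y₂))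
  have hdiff := abs_cos_sub_cos_le_mul (π / 2 * (x₁ - x₂)) (π / 2 * (y₁ - y₂))
  have hhalf_pi : π / 2 ≤ 2 := by linarith [pi_le_four]
  have hpos : 0 < π / 2 := by positivity
  rw [← mul_sub, abs_mul, abs_of_pos hpos] at hsum
  rw [← mul_add, ← mul_sub, abs_mul, abs_mul, abs_of_pos hpos] at hdiff
  have hsum' := hsum.trans (mul_le_mul_of_nonneg_right hhalf_pi (abs_nonneg _))
  have hdiff' : π / 2 * |x₁ - x₂ + (y₁ - y₂)| * (π / 2 * |x₁ - x₂ - (y₁ - y₂)|) ≤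
      2 * |x₁ - x₂ + (y₁ - y₂)| * (2 * |x₁ - x₂ - (y₁ - y₂)|) := by gcongr
  rw [hprod, hprod]
  linarith [(abs_le.1 hsum').1, (abs_le.1 hdiff).2]

theorem log_sin_half_add_log_sin_half_le {x₁ x₂ y₁ y₂ : ℝ} (hx₁ : x₁ ∈ crossingWindow)
    (hx₂ : x₂ ∈ crossingWindow) (hy₁ : y₁ ∈ crossingWindow) (hy₂ : y₂ ∈ crossingWindow) :
    log (sin (π * x₁ / 2)) + log (sin (π * x₂ / 2)) ≤
      log (sin (π * y₁ / 2)) + log (sin (π * y₂ / 2)) +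
        12 * (|x₁ + x₂ - (y₁ + y₂)| + |(x₁ - x₂) + (y₁ - y₂)| * |(x₁ - x₂) - (y₁ - y₂)|) := by
  have hsin (x : ℝ) (hx : x ∈ crossingWindow) : 3 / 10 ≤ sin (π * x / 2) :=
    hx.1.trans (le_sin_half (by linarith [hx.1]) (by linarith [hx.2]))
  have hpos (x : ℝ) (hx : x ∈ crossingWindow) : 0 < sin (π * x / 2) := by linarith [hsin x hx]
  rw [← log_mul (hpos x₁ hx₁).ne' (hpos x₂ hx₂).ne', ← log_mul (hpos y₁ hy₁).ne' (hpos y₂ hy₂).ne']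
  refine log_le_log_add (mul_pos (hpos x₁ hx₁) (hpos x₂ hx₂))
    (mul_pos (hpos y₁ hy₁) (hpos y₂ hy₂)) (by positivity) ?_
  have hlower : 3 / 10 * (3 / 10) ≤ sin (π * y₁ / 2) * sin (π * y₂ / 2) :=
    mul_le_mul (hsin y₁ hy₁) (hsin y₂ hy₂) (by norm_num) (hpos y₁ hy₁).le
  have herror : 0 ≤ |x₁ + x₂ - (y₁ + y₂)| + |(x₁ - x₂) + (y₁ - y₂)| * |(x₁ - x₂) - (y₁ - y₂)| := by
    positivity
  linarith [sin_half_mul_sin_half_sub_le x₁ x₂ y₁ y₂, mul_le_mul_of_nonneg_right hlower herror]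

end TrigonometricFactors

section Separation

variable {ψ : ℝ → ℝ} {a b ε x y v q₁ r₁ q₂ r₂ s₁ t₁ s₂ t₂ : ℝ}
  {X₁ X₂ V₁ V₂ Y₁ Y₂ Z₁ Z₂ : ℝ → ℝ}

theorem IsLayerCurve.sub_le_two_mul (h₁ : IsLayerCurve ψ b ε X₁) (h₂ : IsLayerCurve ψ b ε X₂)
    (hX : X₁ 1 ≤ X₂ 1) (hv : v ∈ Icc (-1) 1) : X₂ v - X₁ v ≤ 2 * (X₂ 1 - X₁ 1) := by
  have hlayer := (abs_le.1 (h₁.abs_sub_sub_le h₂ hv)).2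
  rw [sub_self, abs_zero, add_zero, abs_of_nonneg (sub_nonneg.2 hX)] at hlayer
  have hsmall : 10 ^ 9 * ε * (X₂ 1 - X₁ 1) ≤ 1 * (X₂ 1 - X₁ 1) :=
    mul_le_mul_of_nonneg_right (by linarith [h₁.eps_le]) (sub_nonneg.2 hX)
  linarith

namespace HalfOrbit

theorem lt_of_image_eq (h₁ : HalfOrbit ψ b ε Y₁ q₁ r₁) (h₂ : HalfOrbit ψ b ε Y₂ q₂ r₂)
    (hlt : Y₁ 0 < Y₂ 0) (hx : x ∈ crossingWindow) (hy : y ∈ crossingWindow) (h : Y₁ x = Y₂ y) :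
    x < y := by
  rw [← h₂.strictAntiOn.lt_iff_gt hy hx, ← h]
  exact h₁.isSol.lt_of_lt_at h₁.transition h₂.isSol hlt x

theorem entry_lt_entry (h₁ : HalfOrbit ψ b ε Y₁ q₁ r₁) (h₂ : HalfOrbit ψ b ε Y₂ q₂ r₂)
    (hlt : Y₁ 0 < Y₂ 0) : q₁ < q₂ :=
  h₁.lt_of_image_eq h₂ hlt h₁.entry_mem h₂.entry_mem (h₁.at_entry.trans h₂.at_entry.symm)

theorem exit_lt_exit (h₁ : HalfOrbit ψ b ε Y₁ q₁ r₁) (h₂ : HalfOrbit ψ b ε Y₂ q₂ r₂)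
    (hlt : Y₁ 0 < Y₂ 0) : r₁ < r₂ :=
  h₁.lt_of_image_eq h₂ hlt h₁.exit_mem h₂.exit_mem (h₁.at_exit.trans h₂.at_exit.symm)

theorem exp_mul_sub_entry (h₁ : HalfOrbit ψ b ε Y₁ q₁ r₁) (h₂ : HalfOrbit ψ b ε Y₂ q₂ r₂)
    (hq : q₁ ≤ q₂) : exp (b * q₁) * (Y₂ q₁ - ε) = Y₂ 0 - Y₁ 0 := by
  have hlinear := exp_mul_eq_of_hasDerivAt_neg_mul (f := fun x => Y₂ x - Y₁ x) (b := b) (p := 0)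
    (s := q₁) (h₁.entry_mem.1.trans' (by norm_num)) fun x hx =>
      ((h₂.isSol x).sub (h₁.isSol x)).congr_deriv (by
        rw [scalarField_of_le h₁.transition h₁.eps_pos (h₁.above x hx),
          scalarField_of_le h₁.transition h₁.eps_pos (h₂.above x ⟨hx.1, hx.2.trans hq⟩)]
        ring)
  rwa [h₁.at_entry, mul_zero, exp_zero, one_mul] at hlinear

theorem exp_mul_sub_exit (h₁ : HalfOrbit ψ b ε Y₁ q₁ r₁) (h₂ : HalfOrbit ψ b ε Y₂ q₂ r₂)
    (hr : r₁ ≤ r₂) : exp (b * 2) * (Y₂ 2 - Y₁ 2) = exp (b * r₂) * (-ε - Y₁ r₂) := by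
  have hlinear := exp_mul_eq_of_hasDerivAt_neg_mul (f := fun x => Y₂ x - Y₁ x) (b := b) (p := r₂)
    (s := 2) (h₂.exit_mem.2.trans (by norm_num)) fun x hx =>
      ((h₂.isSol x).sub (h₁.isSol x)).congr_deriv (by
        rw [scalarField_of_le_neg h₁.transition h₁.eps_pos (h₂.below x hx),
          scalarField_of_le_neg h₁.transition h₁.eps_pos (h₁.below x ⟨hr.trans hx.1, hx.2⟩)]
        ring)
  rwa [h₂.at_exit] at hlinear

theorem log_sub_initial (h₁ : HalfOrbit ψ b ε Y₁ q₁ r₁) (h₂ : HalfOrbit ψ b ε Y₂ q₂ r₂)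
    (hlt : Y₁ 0 < Y₂ 0) : log (Y₂ 0 - Y₁ 0) = b * q₁ + log (Y₂ q₁ - ε) := by
  have hq := h₁.entry_lt_entry h₂ hlt
  have hpos := h₂.strictAntiOn h₁.entry_mem h₂.entry_mem hq
  rw [h₂.at_entry] at hpos
  rw [← h₁.exp_mul_sub_entry h₂ hq.le, log_mul (exp_pos _).ne' (sub_pos.2 hpos).ne', log_exp]

theorem log_sub_end (h₁ : HalfOrbit ψ b ε Y₁ q₁ r₁) (h₂ : HalfOrbit ψ b ε Y₂ q₂ r₂)
    (hlt : Y₁ 0 < Y₂ 0) : log (Y₂ 2 - Y₁ 2) = b * (r₂ - 2) + log (-ε - Y₁ r₂) := by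
  have hr := h₁.exit_lt_exit h₂ hlt
  have hpos := h₁.strictAntiOn h₁.exit_mem h₂.exit_mem hr
  rw [h₁.at_exit] at hpos
  have hend := h₁.isSol.lt_of_lt_at h₁.transition h₂.isSol hlt 2
  have hlog := congrArg log (h₁.exp_mul_sub_exit h₂ hr.le)
  rw [log_mul (exp_pos _).ne' (sub_pos.2 hend).ne', log_mul (exp_pos _).ne' (sub_pos.2 hpos).ne',
    log_exp, log_exp] at hlog
  linarith

theorem entry_sub_le (h₁ : HalfOrbit ψ b ε Y₁ q₁ r₁) (h₂ : HalfOrbit ψ b ε Y₂ q₂ r₂)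
    (hlt : Y₁ 0 < Y₂ 0) : q₂ - q₁ ≤ 8000 * (Y₂ 0 - Y₁ 0) := by
  have hq := (h₁.entry_lt_entry h₂ hlt).le
  have hfall := h₂.sub_le hq h₁.entry_mem h₂.entry_mem
  rw [h₂.at_entry] at hfall
  have hdamping : |b * q₁| ≤ 1 / 2 := by
    rw [abs_mul, abs_of_nonneg (h₁.entry_mem.1.trans' (by norm_num))]
    calc |b| * q₁ ≤ 1 / 10 ^ 30 * 1 := by
          gcongr
          · linarith [h₁.entry_mem.1]
          · exact h₁.abs_damping_le
          · linarith [h₁.entry_mem.2]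
      _ ≤ 1 / 2 := by norm_num
  have hexp : 1 / 2 ≤ exp (b * q₁) := by
    linarith [add_one_le_exp (b * q₁), neg_abs_le (b * q₁)]
  have hgap := mul_le_mul_of_nonneg_right hexp
    (show 0 ≤ Y₂ q₁ - ε by linarith)
  rw [h₁.exp_mul_sub_entry h₂ hq] at hgap
  linarith

theorem exit_sub_le (h₁ : HalfOrbit ψ b ε Y₁ q₁ r₁) (h₂ : HalfOrbit ψ b ε Y₂ q₂ r₂)
    (hlt : Y₁ 0 < Y₂ 0) : r₂ - r₁ ≤ 16000 * (Y₂ 0 - Y₁ 0) := by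
  have hentry := h₁.entry_sub_le h₂ hlt
  have hq := (h₁.entry_lt_entry h₂ hlt).le
  obtain ⟨X₁, hX₁, rfl, rfl, -⟩ := h₁.exists_layerCurve
  obtain ⟨X₂, hX₂, rfl, rfl, -⟩ := h₂.exists_layerCurve
  linarith [hX₁.sub_le_two_mul hX₂ hq (v := -1) (by norm_num)]

theorem log_entry_sub_le (h₁ : HalfOrbit ψ b ε Y₁ q₁ r₁) (h₂ : HalfOrbit ψ b ε Y₂ q₂ r₂)
    (hb : 0 ≤ b) (hlt : Y₁ 0 < Y₂ 0) :
    log (1 + 2 * cos (π * q₂)) + log (sin (π * q₁ / 2)) + log (q₂ - q₁) ≤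
      log (Y₂ 0 - Y₁ 0) - b * q₁ := by
  have hq := h₁.entry_lt_entry h₂ hlt
  have hq₁ := h₁.entry_mem
  have hfall := image_sub_le_of_hasDerivAt_le hq.le (fun x _ => h₂.isSol x)
    (C := -((1 + 2 * cos (π * q₂)) * sin (π * q₁ / 2))) fun x hx => by
      have habove := h₂.above x ⟨by linarith [hq₁.1, hx.1], hx.2⟩
      rw [scalarField_of_le h₂.transition h₂.eps_pos habove]
      linarith [mul_sin_half_le_sin_three_half (by linarith [hq₁.1]) h₂.entry_mem hx,
        mul_nonneg hb (h₂.eps_pos.le.trans habove)]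
  rw [h₂.at_entry] at hfall
  have hcos : 0 < 1 + 2 * cos (π * q₂) := by linarith [le_one_add_two_cos h₂.entry_mem]
  have hsin : 0 < sin (π * q₁ / 2) := by
    linarith [le_sin_half (x := q₁) (by linarith [hq₁.1]) (by linarith [hq₁.2]), hq₁.1]
  have hgap : 0 < q₂ - q₁ := sub_pos.2 hq
  rw [h₁.log_sub_initial h₂ hlt, ← log_mul hcos.ne' hsin.ne',
    ← log_mul (mul_pos hcos hsin).ne' hgap.ne', add_sub_cancel_left]
  exact log_le_log (mul_pos (mul_pos hcos hsin) hgap) (by linarith)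

theorem log_sub_initial_le (h₁ : HalfOrbit ψ b ε Y₁ q₁ r₁) (h₂ : HalfOrbit ψ b ε Y₂ q₂ r₂)
    (hb : b ≤ 0) (hlt : Y₁ 0 < Y₂ 0) :
    log (Y₂ 0 - Y₁ 0) - b * q₁ ≤
      log (1 + 2 * cos (π * q₁)) + log (sin (π * q₂ / 2)) + log (q₂ - q₁) := by
  have hq := h₁.entry_lt_entry h₂ hlt
  have hq₂ := h₂.entry_mem
  have hfall := le_image_sub_of_le_hasDerivAt hq.le (fun x _ => h₂.isSol x)
    (C := -((1 + 2 * cos (π * q₁)) * sin (π * q₂ / 2))) fun x hx => by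
      have habove := h₂.above x ⟨by linarith [h₁.entry_mem.1, hx.1], hx.2⟩
      rw [scalarField_of_le h₂.transition h₂.eps_pos habove]
      linarith [sin_three_half_le_mul_sin_half h₁.entry_mem (by linarith [hq₂.2]) hx,
        mul_nonpos_of_nonpos_of_nonneg hb (h₂.eps_pos.le.trans habove)]
  have hpos := h₂.strictAntiOn h₁.entry_mem hq₂ hq
  rw [h₂.at_entry] at hfall hpos
  have hcos : 0 < 1 + 2 * cos (π * q₁) := by linarith [le_one_add_two_cos h₁.entry_mem]
  have hsin : 0 < sin (π * q₂ / 2) := by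
    linarith [le_sin_half (x := q₂) (by linarith [hq₂.1]) (by linarith [hq₂.2]), hq₂.1]
  rw [h₁.log_sub_initial h₂ hlt, ← log_mul hcos.ne' hsin.ne',
    ← log_mul (mul_pos hcos hsin).ne' (sub_pos.2 hq).ne', add_sub_cancel_left]
  exact log_le_log (sub_pos.2 hpos) (by linarith)

theorem log_sub_end_le (h₁ : HalfOrbit ψ b ε Y₁ q₁ r₁) (h₂ : HalfOrbit ψ b ε Y₂ q₂ r₂)
    (hb : 0 ≤ b) (hlt : Y₁ 0 < Y₂ 0) :
    log (Y₂ 2 - Y₁ 2) ≤ b * (r₂ - 2) + (log (sin (π * r₂ / 2)) + log (r₂ - r₁)) := by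
  have hr := h₁.exit_lt_exit h₂ hlt
  have hr₂ := h₂.exit_mem
  have hfall := le_image_sub_of_le_hasDerivAt hr.le (fun x _ => h₁.isSol x)
    (C := -sin (π * r₂ / 2)) fun x hx => by
      have hbelow := h₁.below x ⟨hx.1, by linarith [hx.2, hr₂.2]⟩
      rw [scalarField_of_le_neg h₁.transition h₁.eps_pos hbelow]
      linarith [sin_half_le_sin_half (by linarith [h₁.exit_mem.1, hx.1]) hx.2
        (by linarith [hr₂.2]), mul_nonneg hb (show 0 ≤ -Y₁ x by linarith [h₁.eps_pos])]
  have hpos := h₁.strictAntiOn h₁.exit_mem hr₂ hr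
  rw [h₁.at_exit] at hfall hpos
  have hsin : 0 < sin (π * r₂ / 2) := by
    linarith [le_sin_half (x := r₂) (by linarith [hr₂.1]) (by linarith [hr₂.2]), hr₂.1]
  rw [h₁.log_sub_end h₂ hlt, ← log_mul hsin.ne' (sub_pos.2 hr).ne']
  exact add_le_add_right (log_le_log (sub_pos.2 hpos) (by linarith)) _

theorem log_exit_sub_le (h₁ : HalfOrbit ψ b ε Y₁ q₁ r₁) (h₂ : HalfOrbit ψ b ε Y₂ q₂ r₂)
    (hb : b ≤ 0) (hlt : Y₁ 0 < Y₂ 0) :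
    b * (r₂ - 2) + (log (sin (π * r₁ / 2)) + log (r₂ - r₁)) ≤ log (Y₂ 2 - Y₁ 2) := by
  have hr := h₁.exit_lt_exit h₂ hlt
  have hr₁ := h₁.exit_mem
  have hfall := image_sub_le_of_hasDerivAt_le hr.le (fun x _ => h₁.isSol x)
    (C := -sin (π * r₁ / 2)) fun x hx => by
      have hbelow := h₁.below x ⟨hx.1, by linarith [hx.2, h₂.exit_mem.2]⟩
      rw [scalarField_of_le_neg h₁.transition h₁.eps_pos hbelow]
      linarith [sin_half_le_sin_half (by linarith [hr₁.1]) hx.1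
        (by linarith [h₂.exit_mem.2, hx.2]),
        mul_nonpos_of_nonpos_of_nonneg hb (show 0 ≤ -Y₁ x by linarith [h₁.eps_pos])]
  rw [h₁.at_exit] at hfall
  have hsin : 0 < sin (π * r₁ / 2) := by
    linarith [le_sin_half (x := r₁) (by linarith [hr₁.1]) (by linarith [hr₁.2]), hr₁.1]
  rw [h₁.log_sub_end h₂ hlt, ← log_mul hsin.ne' (sub_pos.2 hr).ne']
  exact add_le_add_right (log_le_log (mul_pos hsin (sub_pos.2 hr)) (by linarith)) _

end HalfOrbit

namespace ReversalPair

theorem initial_lt_initial (p₁ : ReversalPair ψ a ε Y₁ Z₁ q₁ r₁ s₁ t₁)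
    (p₂ : ReversalPair ψ a ε Y₂ Z₂ q₂ r₂ s₂ t₂) (hlt : Y₁ 0 < Y₂ 0) : Z₁ 0 < Z₂ 0 :=
  p₁.initial ▸ p₂.initial ▸ hlt

theorem abs_layer_sub_le (p₁ : ReversalPair ψ a ε Y₁ Z₁ q₁ r₁ s₁ t₁) (hX : IsLayerCurve ψ a ε X₁)
    (hV : IsLayerCurve ψ (-a) ε V₁) (hXq : X₁ 1 = q₁) (hVs : V₁ 1 = s₁) (hv : v ∈ Icc (-1) 1) :
    |X₁ v - V₁ v| ≤ 30000 * a := by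
  have hlayer := abs_le.1 (p₁.abs_layer_sub_sub_le hX hV hXq hVs hv)
  rw [abs_le]
  constructor <;> linarith [p₁.entry_le_entry, p₁.entry_sub_entry_le, p₁.pos]

theorem log_exit_ratio_le (p₁ : ReversalPair ψ a ε Y₁ Z₁ q₁ r₁ s₁ t₁)
    (p₂ : ReversalPair ψ a ε Y₂ Z₂ q₂ r₂ s₂ t₂) (hlt : Y₁ 0 < Y₂ 0)
    (hgap : Y₂ 0 - Y₁ 0 ≤ a / 10 ^ 13) :
    log (r₂ - r₁) - log (t₂ - t₁) ≤ log (q₂ - q₁) - log (s₂ - s₁) + a / 4 := by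
  have hltZ := p₁.initial_lt_initial p₂ hlt
  have hentry := p₁.damped.entry_sub_le p₂.damped hlt
  have hq := p₁.damped.entry_lt_entry p₂.damped hlt
  obtain ⟨X₁, hX₁, hq₁, rfl, hY₁⟩ := p₁.damped.exists_layerCurve
  obtain ⟨X₂, hX₂, hq₂, rfl, hY₂⟩ := p₂.damped.exists_layerCurve
  obtain ⟨V₁, hV₁, hs₁, rfl, hZ₁⟩ := p₁.reversed.exists_layerCurve
  obtain ⟨V₂, hV₂, hs₂, rfl, hZ₂⟩ := p₂.reversed.exists_layerCurve
  have hlog := hX₁.abs_log_sub_le hX₂ hV₁ hV₂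
    (fun v hv => p₁.damped.lt_of_image_eq p₂.damped hlt (hX₁.mem v hv) (hX₂.mem v hv)
      ((hY₁ v hv).trans (hY₂ v hv).symm))
    (fun v hv => p₁.reversed.lt_of_image_eq p₂.reversed hltZ (hV₁.mem v hv) (hV₂.mem v hv)
      ((hZ₁ v hv).trans (hZ₂ v hv).symm))
    (fun v hv => p₁.abs_layer_sub_le hX₁ hV₁ hq₁ hs₁ hv)
    (fun v hv => p₂.abs_layer_sub_le hX₂ hV₂ hq₂ hs₂ hv)
    (fun v hv => (hX₁.sub_le_two_mul hX₂ (by linarith) hv).trans (by linarith [p₁.pos]))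
  rw [hq₁, hq₂, hs₁, hs₂, sub_neg_eq_add, abs_of_pos (add_pos p₁.pos p₁.pos)] at hlog
  have herror : 10 ^ 18 * ε * (30000 * a + (a + a)) ≤
      10 ^ 18 * (1 / 10 ^ 30) * (30000 * a + (a + a)) := by
    gcongr
    · linarith [p₁.pos]
    · exact p₁.damped.eps_le
  linarith [(abs_le.1 hlog).1, p₁.pos]

theorem log_entry_cos_le (p₁ : ReversalPair ψ a ε Y₁ Z₁ q₁ r₁ s₁ t₁)
    (p₂ : ReversalPair ψ a ε Y₂ Z₂ q₂ r₂ s₂ t₂) (hlt : Y₁ 0 < Y₂ 0)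
    (hgap : Y₂ 0 - Y₁ 0 ≤ a / 10 ^ 13) :
    log (1 + 2 * cos (π * s₁)) ≤ log (1 + 2 * cos (π * q₂)) + a / 4 := by
  have hlog := log_one_add_two_cos_le (p₁.damped.entry_lt_entry p₂.damped hlt).le p₁.entry_le_entry
    p₁.damped.entry_mem p₂.damped.entry_mem p₁.reversed.entry_mem
  linarith [p₁.damped.entry_sub_le p₂.damped hlt, p₁.pos]

theorem log_sin_factors_le (p₁ : ReversalPair ψ a ε Y₁ Z₁ q₁ r₁ s₁ t₁)
    (p₂ : ReversalPair ψ a ε Y₂ Z₂ q₂ r₂ s₂ t₂) (hlt : Y₁ 0 < Y₂ 0)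
    (hgap : Y₂ 0 - Y₁ 0 ≤ a / 10 ^ 13) :
    log (sin (π * r₂ / 2)) + log (sin (π * s₂ / 2)) ≤
      log (sin (π * t₁ / 2)) + log (sin (π * q₁ / 2)) + a / 4 := by
  have ha_le := p₁.damping_le
  have hε := p₁.damped.eps_le
  have hltZ := p₁.initial_lt_initial p₂ hlt
  have hs₁ := p₁.reversed.entry_lt_entry p₂.reversed hltZ
  have hs₂ := p₁.reversed.entry_sub_le p₂.reversed hltZ
  rw [← p₁.initial, ← p₂.initial] at hs₂
  have hr₁ := p₁.damped.exit_lt_exit p₂.damped hlt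
  have hr₂ := p₁.damped.exit_sub_le p₂.damped hlt
  have hexit := abs_le.1 p₁.abs_exit_sub_sub_le
  have hlag := p₁.entry_sub_entry_le
  have hlag₀ := p₁.entry_le_entry
  have hqr₀ := p₁.damped.entry_le_exit
  have hqr := p₁.damped.exit_sub_entry_le
  have hsum : |r₂ + s₂ - (t₁ + q₁)| ≤ a / 10 ^ 7 := by
    rw [abs_le]; constructor <;> linarith
  have hdiff : |(r₂ - s₂) + (t₁ - q₁)| ≤ 1 / 10 ^ 20 := by
    rw [abs_le]; constructor <;> linarith
  have hdiff' : |(r₂ - s₂) - (t₁ - q₁)| ≤ 10 ^ 6 * a := by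
    rw [abs_le]; constructor <;> linarith
  have hprod := mul_le_mul hdiff hdiff' (abs_nonneg _) (by norm_num)
  linarith [log_sin_half_add_log_sin_half_le p₂.damped.exit_mem p₂.reversed.entry_mem
    p₁.reversed.exit_mem p₁.damped.entry_mem]

theorem log_end_sub_le (p₁ : ReversalPair ψ a ε Y₁ Z₁ q₁ r₁ s₁ t₁)
    (p₂ : ReversalPair ψ a ε Y₂ Z₂ q₂ r₂ s₂ t₂) (hlt : Y₁ 0 < Y₂ 0)
    (hgap : Y₂ 0 - Y₁ 0 ≤ a / 10 ^ 13) : log (Y₂ 2 - Y₁ 2) ≤ -a + log (Z₂ 2 - Z₁ 2) := by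
  have ha := p₁.pos
  have hltZ := p₁.initial_lt_initial p₂ hlt
  have hneg : -a ≤ 0 := neg_nonpos.2 ha.le
  have hinitial := p₁.reversed.log_sub_initial_le p₂.reversed hneg hltZ
  rw [← p₁.initial, ← p₂.initial] at hinitial
  have hphases : a * (r₂ + t₂ - q₁ - s₁) ≤ a * 1 :=
    mul_le_mul_of_nonneg_left (by linarith [p₂.damped.exit_mem.2, p₂.reversed.exit_mem.2,
      p₁.damped.entry_mem.1, p₁.reversed.entry_mem.1]) ha.le
  linarith [p₁.log_exit_ratio_le p₂ hlt hgap, p₁.log_entry_cos_le p₂ hlt hgap,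
    p₁.log_sin_factors_le p₂ hlt hgap, p₁.damped.log_entry_sub_le p₂.damped ha.le hlt,
    p₁.damped.log_sub_end_le p₂.damped ha.le hlt,
    p₁.reversed.log_exit_sub_le p₂.reversed hneg hltZ]

theorem end_sub_le_exp_mul (p₁ : ReversalPair ψ a ε Y₁ Z₁ q₁ r₁ s₁ t₁)
    (p₂ : ReversalPair ψ a ε Y₂ Z₂ q₂ r₂ s₂ t₂) (hlt : Y₁ 0 < Y₂ 0)
    (hgap : Y₂ 0 - Y₁ 0 ≤ a / 10 ^ 13) : Y₂ 2 - Y₁ 2 ≤ exp (-a) * (Z₂ 2 - Z₁ 2) := by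
  have hY := p₁.damped.isSol.lt_of_lt_at p₁.damped.transition p₂.damped.isSol hlt 2
  have hZ := p₁.reversed.isSol.lt_of_lt_at p₁.damped.transition p₂.reversed.isSol
    (p₁.initial_lt_initial p₂ hlt) 2
  have hexp := exp_le_exp.2 (p₁.log_end_sub_le p₂ hlt hgap)
  rwa [exp_add, exp_log (sub_pos.2 hY), exp_log (sub_pos.2 hZ)] at hexp

end ReversalPair

end Separation

section PeriodicSolution

variable {ψ : ℝ → ℝ} {a ε : ℝ} {W : ℝ → ℝ}

namespace IsAdmissible

theorem exists_reversalPair (h : IsAdmissible ψ a ε) (ha : 0 < a) {Y Z : ℝ → ℝ}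
    (hY : IsSol ψ a ε Y) (hZ : IsSol ψ (-a) ε Z) (hYZ : Y 0 = Z 0)
    (h₀ : Y 0 ∈ Icc initialLow initialHigh) : ∃ q r q' r', ReversalPair ψ a ε Y Z q r q' r' := by
  obtain ⟨q, r, hdamped⟩ := h.exists_halfOrbit hY h₀
  obtain ⟨q', r', hreversed⟩ := h.neg.exists_halfOrbit hZ (hYZ ▸ h₀)
  exact ⟨q, r, q', r', ha, hdamped, hreversed, hYZ⟩

theorem exists_reversalPair_comp_neg (h : IsAdmissible ψ a ε) (ha : 0 < a) {Y : ℝ → ℝ}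
    (hY : IsSol ψ a ε Y) (h₀ : Y 0 ∈ Icc initialLow initialHigh) :
    ∃ q r q' r', ReversalPair ψ a ε Y (fun x => Y (-x)) q r q' r' :=
  h.exists_reversalPair ha hY hY.comp_neg (by rw [neg_zero]) h₀

theorem exists_isSol_image_two_eq (h : IsAdmissible ψ a ε) (ha : 0 < a) :
    ∃ W, IsSol ψ a ε W ∧ W 2 = W (-2) ∧ W 0 ∈ Ioo initialLow initialHigh := by
  have hψ := h.transition
  choose F hF₀ hF using hψ.exists_isSol a ε 0
  choose G hG₀ hG using hψ.exists_isSol (-a) ε 0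
  obtain ⟨K, hK⟩ := hψ.exists_lipschitzWith_scalarField a ε
  obtain ⟨L, hL⟩ := hψ.exists_lipschitzWith_scalarField (-a) ε
  have hcont : Continuous fun c => F c 2 - G c 2 :=
    (continuous_integralCurve_of_initial hK hF₀ hF zero_le_two).sub
      (continuous_integralCurve_of_initial hL hG₀ hG zero_le_two)
  have hpair (c : ℝ) (hc : c ∈ Icc initialLow initialHigh) :
      ∃ q r q' r', ReversalPair ψ a ε (F c) (G c) q r q' r' :=
    h.exists_reversalPair ha (hF c) (hG c) ((hF₀ c).trans (hG₀ c).symm) ((hF₀ c).symm ▸ hc)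
  have hlow : 0 < F initialLow 2 - G initialLow 2 := by
    obtain ⟨q, r, q', r', p⟩ := hpair _ (left_mem_Icc.2 initialLow_le_initialHigh)
    exact sub_pos.2 (p.end_lt_end_of_low (hF₀ _))
  have hhigh : F initialHigh 2 - G initialHigh 2 < 0 := by
    obtain ⟨q, r, q', r', p⟩ := hpair _ (right_mem_Icc.2 initialLow_le_initialHigh)
    exact sub_neg.2 (p.end_lt_end_of_high (hF₀ _))
  obtain ⟨c, hc, hzero⟩ :=
    intermediate_value_Ioo' initialLow_le_initialHigh hcont.continuousOn ⟨hhigh, hlow⟩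
  have hbackward : (fun x => F c (-x)) = G c :=
    (hF c).comp_neg.eq_of_eq_at hψ (hG c) (x₀ := 0) (by rw [neg_zero, hF₀, hG₀])
  exact ⟨F c, hF c, (sub_eq_zero.1 hzero).trans (congrFun hbackward 2).symm, (hF₀ c).symm ▸ hc⟩

theorem end_sub_le (h : IsAdmissible ψ a ε) (ha : 0 < a) {U V : ℝ → ℝ} (hU : IsSol ψ a ε U)
    (hV : IsSol ψ a ε V) (hU₀ : U 0 ∈ Icc initialLow initialHigh)
    (hV₀ : V 0 ∈ Icc initialLow initialHigh) (hlt : U 0 < V 0) (hgap : V 0 - U 0 ≤ a / 10 ^ 13) :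
    V 2 - U 2 ≤ exp (-a) * (V (-2) - U (-2)) := by
  obtain ⟨q₁, r₁, q₁', r₁', p₁⟩ := h.exists_reversalPair_comp_neg ha hU hU₀
  obtain ⟨q₂, r₂, q₂', r₂', p₂⟩ := h.exists_reversalPair_comp_neg ha hV hV₀
  exact p₁.end_sub_le_exp_mul p₂ hlt hgap

theorem dist_end_le (h : IsAdmissible ψ a ε) (ha : 0 < a) {U V : ℝ → ℝ} (hU : IsSol ψ a ε U)
    (hV : IsSol ψ a ε V) (hU₀ : U 0 ∈ Icc initialLow initialHigh)
    (hV₀ : V 0 ∈ Icc initialLow initialHigh) (hgap : dist (V 0) (U 0) ≤ a / 10 ^ 13) :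
    dist (V 2) (U 2) ≤ exp (-a) * dist (V (-2)) (U (-2)) := by
  wlog hle : U 0 ≤ V 0 generalizing U V
  · simpa only [dist_comm] using
      this hV hU hV₀ hU₀ (by rwa [dist_comm]) (le_of_not_ge hle)
  rcases hle.eq_or_lt with heq | hlt
  · rw [hU.eq_of_eq_at h.transition hV heq, dist_self, dist_self, mul_zero]
  have horder := hU.lt_of_lt_at h.transition hV hlt
  simp only [Real.dist_eq, abs_of_pos (sub_pos.2 (horder _))] at hgap ⊢
  exact h.end_sub_le ha hU hV hU₀ hV₀ hlt hgap

theorem exists_contractsTowards (h : IsAdmissible ψ a ε) (ha : 0 < a) (hW : IsSol ψ a ε W)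
    (hW₀ : W 0 ∈ Ioo initialLow initialHigh) :
    ∃ d > 0, ContractsTowards (scalarField ψ a ε) W 4 (exp (-a)) d (-2) := by
  obtain ⟨K, hK⟩ := h.transition.exists_lipschitzWith_scalarField a ε
  obtain ⟨δ, hδ, hball⟩ := Metric.nhds_basis_closedBall.mem_iff.1 (Icc_mem_nhds hW₀.1 hW₀.2)
  refine ⟨min δ (a / 10 ^ 13) / exp (K * 2), by positivity, fun V hV hclose => ?_⟩
  rw [le_div_iff₀' (exp_pos _)] at hclose
  have hclose₀ : dist (V 0) (W 0) ≤ min δ (a / 10 ^ 13) :=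
    (dist_integralCurve_le_of_le_add hK hV hW (s := -2) (t := 0) (T := 2) (by norm_num)
      (by norm_num)).trans hclose
  have hend := h.dist_end_le ha hW hV (Ioo_subset_Icc_self hW₀)
    (hball (hclose₀.trans (min_le_left _ _))) (hclose₀.trans (min_le_right _ _))
  rwa [show (-2 : ℝ) + 4 = 2 by norm_num]

end IsAdmissible

theorem IsSol.periodic (hψ : IsLipschitzTransition ψ) (hW : IsSol ψ a ε W)
    (h : W 2 = W (-2)) : Function.Periodic W 4 := by
  have hshift : IsSol ψ a ε fun x => W (x + (1 : ℤ) * 4) :=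
    integralCurve_comp_add_int_mul periodic_scalarField hW 1
  have heq := hshift.eq_of_eq_at hψ hW (x₀ := -2) (by norm_num [h])
  exact fun x => by simpa using congrFun heq x

theorem IsAdmissible.isAsymptoticallyStableSolution (h : IsAdmissible ψ a ε) (ha : 0 < a)
    (hW : IsSol ψ a ε W) (hper : Function.Periodic W 4) (hW₀ : W 0 ∈ Ioo initialLow initialHigh) :
    IsAsymptoticallyStableSolution (scalarField ψ a ε) W := by
  obtain ⟨K, hK⟩ := h.transition.exists_lipschitzWith_scalarField a ε
  obtain ⟨d, hd, hcon⟩ := h.exists_contractsTowards ha hW hW₀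
  exact hcon.isAsymptoticallyStableSolution hK four_pos periodic_scalarField hW hper
    (exp_pos _).le (exp_lt_one_iff.2 (neg_neg_of_pos ha)) hd

end PeriodicSolution

section Orbit

variable {ψ : ℝ → ℝ} {a ε : ℝ} {V W : ℝ → ℝ} {q r : ℝ}

/-- The curve in the `(x, v)` plane, `v = y / ε`, given by a function `y = W x` and parametrized by
the phase. -/
noncomputable def orbit (ε : ℝ) (W : ℝ → ℝ) (t : ℝ) : ℝ × ℝ :=
  (t, W t / ε)

theorem IsSol.isIntegralCurve_orbit (hε : ε ≠ 0) (hW : IsSol ψ a ε W) :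
    IsIntegralCurve (orbit ε W) fun _ => regField ψ a ε := fun t => by
  refine ((hasDerivAt_id t).prodMk ((hW t).div_const ε)).congr_deriv ?_
  simp only [regField, orbit, scalarField, mul_assoc, mul_div_cancel₀ _ hε]

theorem orbit_add_eq_iff (hε : ε ≠ 0) {S t : ℝ} :
    orbit ε W (t + S) = orbit ε W t + (S, 0) ↔ W (t + S) = W t := by
  simp only [orbit, Prod.mk_add_mk, add_zero, Prod.mk.injEq, true_and, div_left_inj' hε]

/- Below the layer the phase can be read off the slope `-a W - sin (πx/2)`. -/
theorem HalfOrbit.sin_eq_zero_of_periodic (h : HalfOrbit ψ a ε W q r) {S : ℝ}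
    (hS : Function.Periodic W S) : sin (π * S / 2) = 0 := by
  have hbelow : W 2 ≤ -ε := h.below 2 ⟨h.exit_mem.2.trans (by norm_num), le_rfl⟩
  have hshift := (h.isSol (2 + S)).comp_add_const 2 S
  rw [funext hS] at hshift
  have hslope := hshift.unique (h.isSol 2)
  rw [hS, scalarField_of_le_neg h.transition h.eps_pos hbelow,
    scalarField_of_le_neg h.transition h.eps_pos hbelow,
    show π * (2 + S) / 2 = π * S / 2 + π by ring, sin_add_pi, mul_div_cancel_right₀ π two_ne_zero,
    sin_pi] at hslope
  linarith

theorem eq_two_of_sin_pi_mul_half_eq_zero {S : ℝ} (h₀ : 0 < S) (h₄ : S < 4)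
    (h : sin (π * S / 2) = 0) : S = 2 := by
  obtain ⟨n, hn⟩ := sin_eq_zero_iff.1 h
  have hnS : S = 2 * n := by
    have := mul_left_cancel₀ pi_ne_zero (show π * n = π * (S / 2) by linear_combination hn)
    linarith
  have hn₀ : 0 < n := by exact_mod_cast (by linarith : (0 : ℝ) < n)
  have hn₂ : n < 2 := by exact_mod_cast (by linarith : (n : ℝ) < 2)
  rw [hnS, show n = 1 by omega]
  norm_num

theorem HalfOrbit.hasLeastPeriod_orbit (h : HalfOrbit ψ a ε W q r) (hper : Function.Periodic W 4) :
    HasLeastPeriod (orbit ε W) 4 := by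
  have hε := h.eps_pos
  refine ⟨four_pos, fun t => (orbit_add_eq_iff hε.ne').2 (hper t), fun S hS hperS => ?_⟩
  have hWS : Function.Periodic W S := fun t => (orbit_add_eq_iff hε.ne').1 (hperS t)
  by_contra! hlt
  have htwo := eq_two_of_sin_pi_mul_half_eq_zero hS hlt (h.sin_eq_zero_of_periodic hWS)
  have habove : ε ≤ W 0 := h.above 0 ⟨le_rfl, h.entry_mem.1.trans' (by norm_num)⟩
  have hbelow : W 2 ≤ -ε := h.below 2 ⟨h.exit_mem.2.trans (by norm_num), le_rfl⟩
  have hreturn := hWS 0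
  rw [zero_add, htwo] at hreturn
  linarith

theorem HalfOrbit.forcing_ne_zero_of_abs_lt (h : HalfOrbit ψ a ε W q r) {x : ℝ}
    (hx : x ∈ Icc (0 : ℝ) 2) (hlayer : |W x| < ε) (w : ℝ) : forcing x (ψ w) ≠ 0 := by
  have hlayer' := abs_lt.1 hlayer
  have hentry : q ≤ x := by
    by_contra! hlt
    linarith [h.above x ⟨hx.1, hlt.le⟩]
  have hexit : x ≤ r := by
    by_contra! hlt
    linarith [h.below x ⟨hlt.le, hx.2⟩]
  have hforcing : 1 / 2000 ≤ forcing x (ψ w) :=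
    le_forcing ⟨h.le_entry.trans hentry, hexit.trans h.exit_le⟩ (h.transition.abs_le_one w)
  linarith

theorem ReversalPair.nonSliding_orbit {q' r' : ℝ}
    (p : ReversalPair ψ a ε W (fun x => W (-x)) q r q' r') (hper : Function.Periodic W 4) :
    NonSliding ψ (orbit ε W) := by
  have hε := p.damped.eps_pos
  have hperiod (x : ℝ) (hx : x ∈ Icc (-2 : ℝ) 2) (hlayer : |W x| < ε) (w : ℝ) :
      forcing x (ψ w) ≠ 0 := by
    rcases le_total 0 x with h₀ | h₀
    · exact p.damped.forcing_ne_zero_of_abs_lt ⟨h₀, hx.2⟩ hlayer w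
    · rw [← neg_ne_zero, ← forcing_neg]
      exact p.reversed.forcing_ne_zero_of_abs_lt ⟨by linarith, by linarith [hx.1]⟩
        (by simpa only [neg_neg] using hlayer) w
  rintro t hlayer w ⟨hw, -⟩
  simp only [orbit] at hlayer hw
  rw [abs_div, abs_of_pos hε, div_lt_one hε] at hlayer
  obtain ⟨n, hn, -⟩ := existsUnique_sub_zsmul_mem_Ico four_pos t (-2)
  have hforcing : Function.Periodic (fun x => forcing x (ψ w)) 4 := fun x =>
    congrFun (forcing_periodic x) _
  refine hperiod (t - n • 4) ⟨hn.1, by linarith [hn.2]⟩ ?_ w ?_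
  · rwa [hper.sub_zsmul_eq]
  · exact (hforcing.sub_zsmul_eq n).trans hw

end Orbit

section OrbitalStability

variable {ψ : ℝ → ℝ} {a ε : ℝ} {V W : ℝ → ℝ}

theorem fst_eq_add_of_isIntegralCurveOn_regField {σ : ℝ → ℝ × ℝ}
    (hσ : IsIntegralCurveOn σ (fun _ => regField ψ a ε) (Ici 0)) {t : ℝ} (ht : 0 ≤ t) :
    (σ t).1 = (σ 0).1 + t := by
  have hderiv (s : ℝ) (hs : 0 ≤ s) : HasDerivWithinAt (fun s => (σ s).1 - s) 0 (Ici 0) s := by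
    have hfst : HasDerivWithinAt (fun s => (σ s).1) 1 (Ici 0) s := (hσ s hs).fst
    exact (hfst.sub (hasDerivWithinAt_id s _)).congr_deriv (sub_self 1)
  have hconst := constant_of_has_deriv_right_zero (a := 0) (b := t)
    (fun s hs => (hderiv s hs.1).continuousWithinAt.mono Icc_subset_Ici_self)
    (fun s hs => (hderiv s hs.1).mono (Ici_subset_Ici.2 hs.1)) t (right_mem_Icc.2 ht)
  linarith

theorem eq_orbit_of_isIntegralCurveOn_regField (hψ : IsLipschitzTransition ψ) (hε : ε ≠ 0)
    {σ : ℝ → ℝ × ℝ} (hσ : IsIntegralCurveOn σ (fun _ => regField ψ a ε) (Ici 0))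
    (hV : IsSol ψ a ε V) (h₀ : V (σ 0).1 = ε * (σ 0).2) {t : ℝ} (ht : 0 ≤ t) :
    σ t = orbit ε V ((σ 0).1 + t) := by
  obtain ⟨K, hK⟩ := hψ.exists_lipschitzWith_scalarField a ε
  have hderiv (s : ℝ) (hs : 0 ≤ s) : HasDerivWithinAt (fun s => ε * (σ s).2)
      (scalarField ψ a ε ((σ 0).1 + s) (ε * (σ s).2)) (Ici 0) s := by
    have hsnd : HasDerivWithinAt (fun s => (σ s).2) (regField ψ a ε (σ s)).2 (Ici 0) s :=
      (hσ s hs).snd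
    refine (hsnd.const_mul ε).congr_deriv ?_
    simp only [regField, scalarField, fst_eq_add_of_isIntegralCurveOn_regField hσ hs,
      mul_div_cancel₀ _ hε, mul_div_cancel_left₀ _ hε, mul_assoc]
  have hsol : ε * (σ t).2 = V ((σ 0).1 + t) :=
    ODE_solution_unique (a := 0) (b := t) (f := fun s => ε * (σ s).2)
      (g := fun s => V ((σ 0).1 + s)) (fun s => hK ((σ 0).1 + s))
      (fun s hs => (hderiv s hs.1).continuousWithinAt.mono Icc_subset_Ici_self)
      (fun s hs => (hderiv s hs.1).mono (Ici_subset_Ici.2 hs.1))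
      (hV.continuous.comp (continuous_const_add _)).continuousOn
      (fun s _ => ((hV _).comp_const_add (σ 0).1 s).hasDerivWithinAt)
      (by rw [add_zero, h₀]) (right_mem_Icc.2 ht)
  refine Prod.ext (fst_eq_add_of_isIntegralCurveOn_regField hσ ht) ?_
  rw [orbit, ← hsol, mul_div_cancel_left₀ _ hε]

theorem IsSol.exists_lipschitzWith (hψ : IsLipschitzTransition ψ) (hW : IsSol ψ a ε W)
    (hper : Function.Periodic W 4) : ∃ M : ℝ≥0, LipschitzWith M W := by
  obtain ⟨B, hB⟩ :=
    (hper.compact_of_continuous four_ne_zero hW.continuous).isBounded.exists_norm_le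
  have hWB (x : ℝ) : ‖W x‖₊ ≤ B.toNNReal := by
    rw [← NNReal.coe_le_coe, coe_nnnorm]
    exact (hB _ (mem_range_self x)).trans (le_coe_toNNReal B)
  refine ⟨‖a‖₊ * B.toNNReal + 1, lipschitzWith_of_nnnorm_deriv_le
    (fun x => (hW x).differentiableAt) fun x => ?_⟩
  rw [(hW x).deriv]
  refine (nnnorm_sub_le _ _).trans (add_le_add ?_ ?_)
  · rw [nnnorm_neg, nnnorm_mul]
    gcongr
    exact hWB x
  · exact abs_forcing_le_one x (hψ.abs_le_one _)

theorem dist_orbit_orbit (hε : 0 < ε) (x : ℝ) :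
    dist (orbit ε V x) (orbit ε W x) = dist (V x) (W x) / ε := by
  rw [Prod.dist_eq]
  simp only [orbit, dist_self, Real.dist_eq, ← sub_div, abs_div, abs_of_pos hε]
  exact max_eq_right (by positivity)

theorem dist_le_of_infDist_orbit_lt (hε : 0 < ε) {M : ℝ≥0} (hM : LipschitzWith M W) {p : ℝ × ℝ}
    {δ : ℝ} (hp : Metric.infDist p (range (orbit ε W)) < δ) :
    dist (ε * p.2) (W p.1) ≤ (ε + M) * δ := by
  obtain ⟨_, ⟨s, rfl⟩, hs⟩ := (Metric.infDist_lt_iff (range_nonempty _)).1 hp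
  rw [Prod.dist_eq, max_lt_iff] at hs
  have hvertical : dist (ε * p.2) (W s) ≤ ε * δ := by
    have hscale : W s = ε * (W s / ε) := (mul_div_cancel₀ _ hε.ne').symm
    rw [hscale, ← smul_eq_mul, ← smul_eq_mul, dist_smul₀, norm_of_nonneg hε.le]
    exact mul_le_mul_of_nonneg_left hs.2.le hε.le
  have hhorizontal : dist (W s) (W p.1) ≤ M * δ := by
    rw [dist_comm]
    exact (hM.dist_le_mul _ _).trans (mul_le_mul_of_nonneg_left hs.1.le M.2)
  linarith [dist_triangle (ε * p.2) (W s) (W p.1)]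

theorem exists_forall_infDist_orbit_le (hψ : IsLipschitzTransition ψ) (hε : 0 < ε)
    (hW : IsSol ψ a ε W) (hper : Function.Periodic W 4) {h : ℝ} (hh : 0 < h) :
    ∃ δ > 0, ∀ σ, IsIntegralCurveOn σ (fun _ => regField ψ a ε) (Ici 0) →
      Metric.infDist (σ 0) (range (orbit ε W)) < δ →
        ∃ V x₀, IsSol ψ a ε V ∧ dist (V x₀) (W x₀) ≤ h ∧ ∀ t, 0 ≤ t →
          Metric.infDist (σ t) (range (orbit ε W)) ≤ dist (V (x₀ + t)) (W (x₀ + t)) / ε := by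
  obtain ⟨M, hM⟩ := hW.exists_lipschitzWith hψ hper
  refine ⟨h / (ε + M), by positivity, fun σ hσ hclose => ?_⟩
  obtain ⟨V, hV₀, hV⟩ := hψ.exists_isSol a ε (σ 0).1 (ε * (σ 0).2)
  refine ⟨V, (σ 0).1, hV, ?_, fun t ht => ?_⟩
  · have hle := dist_le_of_infDist_orbit_lt hε hM hclose
    rwa [mul_div_cancel₀ _ (by positivity), ← hV₀] at hle
  · rw [eq_orbit_of_isIntegralCurveOn_regField hψ hε.ne' hσ hV hV₀ ht, ← dist_orbit_orbit hε]
    exact Metric.infDist_le_dist_of_mem (mem_range_self _)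

theorem isLocallyAsymptoticallyStable_orbit (hψ : IsLipschitzTransition ψ) (hε : 0 < ε)
    (hW : IsSol ψ a ε W) (hper : Function.Periodic W 4)
    (hstable : IsAsymptoticallyStableSolution (scalarField ψ a ε) W) :
    IsLocallyAsymptoticallyStable (regField ψ a ε) (range (orbit ε W)) := by
  obtain ⟨h, hh, C, hC, hstable⟩ := hstable
  constructor
  · intro η hη
    obtain ⟨δ, hδ, hshadow⟩ := exists_forall_infDist_orbit_le hψ hε hW hper
      (lt_min hh (by positivity : 0 < η * ε / (2 * C)))
    refine ⟨δ, hδ, fun σ hσ hclose t ht => ?_⟩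
    obtain ⟨V, x₀, hV, hV₀, hinfDist⟩ := hshadow σ hσ hclose
    have hgrowth := (hstable V hV x₀ (hV₀.trans (min_le_left _ _))).1 (x₀ + t) (by linarith)
    have hsmall := (le_div_iff₀ (by positivity)).1 (hV₀.trans (min_le_right _ _))
    refine (hinfDist t ht).trans_lt ((div_lt_iff₀ hε).2 ?_)
    linarith [mul_pos hη hε]
  · obtain ⟨δ, hδ, hshadow⟩ := exists_forall_infDist_orbit_le hψ hε hW hper hh
    refine ⟨δ, hδ, fun σ hσ hclose => ?_⟩
    obtain ⟨V, x₀, hV, hV₀, hinfDist⟩ := hshadow σ hσ hclose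
    have hlim := ((hstable V hV x₀ hV₀).2.comp
      (tendsto_atTop_add_const_left atTop x₀ tendsto_id)).div_const ε
    rw [zero_div] at hlim
    refine squeeze_zero' (Eventually.of_forall fun _ => Metric.infDist_nonneg) ?_ hlim
    filter_upwards [eventually_ge_atTop 0] with t ht using hinfDist t ht

end OrbitalStability

end SwitchedOscillator

open SwitchedOscillator

theorem mainTheorem6_general :
    ∃ a₀ : ℝ, 0 < a₀ ∧ ∃ ε₀ : ℝ, 0 < ε₀ ∧ ∀ ψ : ℝ → ℝ, IsLipschitzTransition ψ →
      ∀ a : ℝ, 0 < a → a < a₀ → ∀ ε : ℝ, 0 < ε → ε < ε₀ →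
        ∃ γ : ℝ → ℝ × ℝ, IsIntegralCurve γ (fun _ => regField ψ a ε) ∧ HasLeastPeriod γ 4 ∧
          NonSliding ψ γ ∧ IsLocallyAsymptoticallyStable (regField ψ a ε) (range γ) := by
  refine ⟨1 / 10 ^ 30, by norm_num, 1 / 10 ^ 30, by norm_num,
    fun ψ hψ a ha ha₀ ε hε hε₀ => ?_⟩
  have h : IsAdmissible ψ a ε := ⟨hψ, hε, hε₀.le, (abs_of_pos ha).trans_le ha₀.le⟩
  obtain ⟨W, hW, hsymm, hW₀⟩ := h.exists_isSol_image_two_eq ha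
  have hper := hW.periodic hψ hsymm
  obtain ⟨q, r, q', r', p⟩ :=
    h.exists_reversalPair_comp_neg ha hW (Ioo_subset_Icc_self hW₀)
  exact ⟨orbit ε W, hW.isIntegralCurve_orbit hε.ne', p.damped.hasLeastPeriod_orbit hper,
    p.nonSliding_orbit hper, isLocallyAsymptoticallyStable_orbit hψ hε hW hper
      (h.isAsymptoticallyStableSolution ha hW hper hW₀)⟩

theorem mainTheorem6 (ψ : ℝ → ℝ) (hψ : SwitchedOscillator.IsTransition ψ) :
    ∃ a₀ : ℝ, 0 < a₀ ∧ ∃ ε₀ : ℝ, 0 < ε₀ ∧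
      ∀ a : ℝ, 0 < a → a < a₀ → ∀ ε : ℝ, 0 < ε → ε < ε₀ →
        ∃ γ : ℝ → ℝ × ℝ,
          IsIntegralCurve γ (fun _ => SwitchedOscillator.regField ψ a ε) ∧
          SwitchedOscillator.HasLeastPeriod γ 4 ∧
          SwitchedOscillator.NonSliding ψ γ ∧
          SwitchedOscillator.IsLocallyAsymptoticallyStable
            (SwitchedOscillator.regField ψ a ε) (Set.range γ) := by
  obtain ⟨a₀, ha₀, ε₀, hε₀, h⟩ := mainTheorem6_general
  exact ⟨a₀, ha₀, ε₀, hε₀, h ψ hψ.isLipschitzTransition⟩
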